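/- Encode opening and closing brackets by $+$ and $-$. A \emph{re-pairing} of a Dyck word $\sigma$ of length $N$ is a sequence $p=(p_1,\dots,p_{N/2})$ of pairs $p_i=(\ell_i,r_i)$ of positions such that $\sigma(\ell_i)=+$, $\sigma(r_i)=-$ and $\ell_i<r_i$ for all $i$, and every position in $[1,N]$ occurs in exactly one pair. The width of a finite set of integers is the smallest number of intervals $[a,b]=\{x\in\mathbb Z: a\le x\le b\}$ whose union it is. The width of $p$ is the maximum over $t$ of the width of the set $\{\ell_i,r_i : i\le t\}$, and $\operatorname{width}(\sigma)$ is the minimum width of a re-pairing of $\sigma$. For positive integers $a_0,a_1,\dots$ let $X(a_0)={+}^{a_0}{-}^{a_0}$ and $X(a_0,\dots,a_k)={+}^{a_k}X(a_0,\dots,a_{k-1})X(a_0,\dots,a_{k-1}){-}^{a_k}$. For $\ell\ge 2$ let $Y(\ell)=X(a_0,\dots,a_{m\ell-1})$, where $m=\lfloor \ell\log_2\ell\rfloor$ and $a_i=2^{\lfloor i/\ell\rfloor}$. **Theorem.** The Dyck words $Y(\ell)$ satisfy, as $\ell\to\infty$, $$\operatorname{width}(Y(\ell))=\Omega\left(\sqrt{\frac{\log|Y(\ell)|}{\log\log|Y(\ell)|}}\right)\qquad\text{and}\qquad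 \operatorname{width}(Y(\ell))=\Omega(\ell),$$ and these two bounds are equivalent: $\sqrt{\log|Y(\ell)|/\log\log|Y(\ell)|}=\Theta(\ell)$. Here $|\cdot|$ denotes length and $\log$ is the binary logarithm. -/

import Mathlib

namespace Dyck

/-- The width of a set `S` of integers: the smallest number of intervals
`[a, b] = {x : ℤ | a ≤ x ≤ b}` whose union is equal to `S`. It is applied to finite sets only,
for which such a number exists. -/
noncomputable def setWidth (S : Set ℤ) : ℕ :=
  sInf {k : ℕ | ∃ I : Fin k → ℤ × ℤ, S = ⋃ i, Set.Icc (I i).1 (I i).2}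

/-- A re-pairing of a Dyck word `σ` of length `N`: a sequence of `N / 2` pairs `(left i, right i)`
of positions such that `left i` carries an opening bracket, `right i` a closing one,
`left i < right i`, and every position occurs in exactly one pair.
Positions and times are counted from `0`. -/
structure RePairing (σ : DyckWord) where
  left : Fin (σ.toList.length / 2) → Fin σ.toList.length
  right : Fin (σ.toList.length / 2) → Fin σ.toList.length
  left_open : ∀ i, σ.toList.get (left i) = DyckStep.U
  right_close : ∀ i, σ.toList.get (right i) = DyckStep.D
  left_lt_right : ∀ i, left i < right i
  exactly_one : ∀ b : Fin σ.toList.length, ∃! i, b = left i ∨ b = right i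

/-- The set of the positions erased by the first `t` pairs of a re-pairing. -/
def RePairing.erased {σ : DyckWord} (p : RePairing σ) (t : ℕ) : Set ℤ :=
  {b : ℤ | ∃ i : Fin (σ.toList.length / 2), (i : ℕ) < t ∧
    (b = ((p.left i : ℕ) : ℤ) ∨ b = ((p.right i : ℕ) : ℤ))}

/-- The width of a re-pairing: the maximum over all times `t = 0, …, N / 2` of the width of the
set of the positions erased up to time `t`. -/
noncomputable def RePairing.width {σ : DyckWord} (p : RePairing σ) : ℕ :=
  (Finset.range (σ.toList.length / 2 + 1)).sup fun t => setWidth (p.erased t)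

/-- The width of a Dyck word: the minimum of the widths of its re-pairings
(every Dyck word has one). -/
noncomputable def width (σ : DyckWord) : ℕ :=
  sInf (Set.range fun p : RePairing σ => p.width)

/-- The word `+ᵃ w -ᵃ`. -/
def frame (a : ℕ) (w : DyckWord) : DyckWord where
  toList := List.replicate a DyckStep.U ++ w.toList ++ List.replicate a DyckStep.D
  count_U_eq_count_D := by
    have h := w.count_U_eq_count_D
    simp [List.count_replicate, h]
    omega
  count_D_le_count_U i := by
    have h := w.count_U_eq_count_D
    have h' := w.count_D_le_count_U (i - a)
    rcases le_or_gt i (a + w.toList.length) with hi | hi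
    · simp [List.take_append, List.take_replicate, List.count_replicate]
      omega
    · have h1 : w.toList.take (i - a) = w.toList := List.take_of_length_le (by omega)
      simp [List.take_append, List.take_replicate, List.count_replicate, h1, h]
      omega

/-- The word `X(a₀, …, aₖ)`: `X(a₀) = +^a₀ -^a₀` and
`X(a₀, …, aₖ₊₁) = +^aₖ₊₁ X(a₀, …, aₖ) X(a₀, …, aₖ) -^aₖ₊₁`
(in Mathlib, the sum of Dyck words is concatenation and `0` is the empty word). -/
def X (a : ℕ → ℕ) : ℕ → DyckWord
  | 0 => frame (a 0) 0
  | k + 1 => frame (a (k + 1)) (X a k + X a k)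

/-- The word `Y(m, ℓ) = X(a₀, …, a_{mℓ-1})` with `aᵢ = 2 ^ ⌊i / ℓ⌋`, for `m ≥ 1` and `ℓ ≥ 1`. -/
def Y₂ (m ℓ : ℕ) : DyckWord := X (fun i => 2 ^ (i / ℓ)) (m * ℓ - 1)

/-- The word `Y(ℓ) = Y(⌊ℓ log₂ ℓ⌋, ℓ)`, for `ℓ ≥ 2` (so that `⌊ℓ log₂ ℓ⌋ ≥ 1`). -/
noncomputable def Y (ℓ : ℕ) : DyckWord := Y₂ ⌊(ℓ : ℝ) * Real.logb 2 ℓ⌋₊ ℓ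

/-- The quantity `√(log |σ| / log log |σ|)`, with binary logarithms. -/
noncomputable def sqrtLogRatio (σ : DyckWord) : ℝ :=
  Real.sqrt (Real.logb 2 (σ.toList.length : ℝ) /
    Real.logb 2 (Real.logb 2 (σ.toList.length : ℝ)))

end Dyck

/-! The main quantity is the flow through a cut: the number of pairs erased so far that cross it. It
never decreases in time and ends at the height of the word. Along the word it changes by the height
step at an erased position and stays constant across an unerased one.

View `X` as a binary tree whose subtrees are hills. Fix a window `[l, r)` whose ends are crossed by
no new pair for a while, and a tree in it that is untouched at the start of this period. A valley
splits the tree into halves; choose two small subtrees high up in each half. Suppose each of the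
four has a moment when it is partly erased and has as many runs as the window. The earliest moment
leaves an erased position on its side of the valley. On the other side, consider the earlier of the
two moments. If it belongs to the small subtree far from the valley, the unfinished near one
separates that position from it, giving an extra run. If it belongs to the near one, a run climbs
out of the valley, and conservation of flow forbids it to stop on the hill, so it has already
swallowed the far one, which was to be unfinished later. Hence one of the four always leaves an
extra run outside (`Play.exists_uncritical`).

To iterate inside that subtree, its own ends must be quiet. Their flows grow at most `2 * H` times,
and each growth step catches at most `2 * w + 2` disjoint subtrees half erased, so among `2 ^ d`
subtrees one is erased with both ends quiet (`Play.exists_quiet_interval`).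

Each round uses `e + 2 + d` levels and gains a run (`Play.exists_runs_ge`). For `Y ℓ` a round costs
`O(ℓ log ℓ)` of about `ℓ² log ℓ` levels, which leaves room for `Ω(ℓ)` rounds. -/

namespace Dyck

/-! ### Heights of bracket sequences and of the words `X` -/

/-- The height of a bracket sequence after its first `x` letters. -/
def height (l : List DyckStep) (x : ℕ) : ℤ :=
  ((l.take x).count DyckStep.U : ℤ) - (l.take x).count DyckStep.D

@[simp] lemma height_zero (l : List DyckStep) : height l 0 = 0 := by simp [height]

lemma height_append_left (u v : List DyckStep) {i : ℕ} (hi : i ≤ u.length) :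
    height (u ++ v) i = height u i := by
  simp [height, List.take_append, Nat.sub_eq_zero_of_le hi]

lemma height_append_right (u v : List DyckStep) (i : ℕ) :
    height (u ++ v) (u.length + i) = height u u.length + height v i := by
  simp [height, List.take_append, List.take_of_length_le]
  ring

lemma height_succ (l : List DyckStep) (x : Fin l.length) :
    height l (x + 1) = height l x + if l.get x = DyckStep.U then 1 else -1 := by
  have h : l.take (x + 1) = l.take x ++ [l.get x] := by simp
  rw [height, height, h, List.count_append, List.count_append]
  rcases l.get x with _ | _ <;> simp <;> ring

lemma height_replicate_U {a i : ℕ} (hi : i ≤ a) :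
    height (List.replicate a DyckStep.U) i = i := by
  simp [height, List.take_replicate, List.count_replicate, hi]

lemma height_replicate_D {a i : ℕ} (hi : i ≤ a) :
    height (List.replicate a DyckStep.D) i = -i := by
  simp [height, List.take_replicate, List.count_replicate, hi]

lemma height_nonneg (σ : DyckWord) (x : ℕ) : 0 ≤ height σ.toList x := by
  have := σ.count_D_le_count_U x
  simp only [height]
  omega

lemma height_length (σ : DyckWord) : height σ.toList σ.toList.length = 0 := by
  simp [height, σ.count_U_eq_count_D]

lemma toList_X_zero (a : ℕ → ℕ) : (X a 0).toList =
    List.replicate (a 0) DyckStep.U ++ [] ++ List.replicate (a 0) DyckStep.D := rfl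

lemma toList_X_succ (a : ℕ → ℕ) (L : ℕ) : (X a (L + 1)).toList =
    List.replicate (a (L + 1)) DyckStep.U ++ ((X a L).toList ++ (X a L).toList) ++
      List.replicate (a (L + 1)) DyckStep.D := rfl

/-- The length of `X(a₀, …, a_L)`. -/
def len (a : ℕ → ℕ) (L : ℕ) : ℕ := (X a L).toList.length

lemma len_zero (a : ℕ → ℕ) : len a 0 = a 0 + a 0 := by
  simp [len, toList_X_zero]

lemma len_succ (a : ℕ → ℕ) (L : ℕ) :
    len a (L + 1) = a (L + 1) + len a L + len a L + a (L + 1) := by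
  simp only [len, toList_X_succ, List.length_append, List.length_replicate]
  omega

lemma height_X_prefix (a : ℕ → ℕ) (L : ℕ) {i : ℕ} (hi : i ≤ a (L + 1)) :
    height (X a (L + 1)).toList i = i := by
  rw [toList_X_succ, height_append_left _ _ (by simp; omega),
    height_append_left _ _ (by simpa), height_replicate_U hi]

lemma height_X_fst (a : ℕ → ℕ) (L : ℕ) {i : ℕ} (hi : i ≤ len a L) :
    height (X a (L + 1)).toList (a (L + 1) + i) = a (L + 1) + height (X a L).toList i := by
  have hi' : i ≤ (X a L).toList.length := hi
  have h := height_append_right (List.replicate (a (L + 1)) DyckStep.U)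
    ((X a L).toList ++ (X a L).toList) i
  rw [List.length_replicate, height_replicate_U le_rfl, height_append_left _ _ hi'] at h
  rw [toList_X_succ, height_append_left _ _ (by simp; omega), h]

lemma height_X_snd (a : ℕ → ℕ) (L : ℕ) {i : ℕ} (hi : i ≤ len a L) :
    height (X a (L + 1)).toList (a (L + 1) + len a L + i) =
      a (L + 1) + height (X a L).toList i := by
  have hi' : i ≤ (X a L).toList.length := hi
  have h := height_append_right (List.replicate (a (L + 1)) DyckStep.U)
    ((X a L).toList ++ (X a L).toList) (len a L + i)
  rw [List.length_replicate, height_replicate_U le_rfl, len, height_append_right,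
    height_length, zero_add, ← add_assoc] at h
  rw [toList_X_succ, height_append_left _ _ (by simp [len]; omega), len, h]

lemma height_X_suffix (a : ℕ → ℕ) (L : ℕ) {i : ℕ} (hi : i ≤ a (L + 1)) :
    height (X a (L + 1)).toList (a (L + 1) + len a L + len a L + i) = a (L + 1) - i := by
  have h := height_append_right (List.replicate (a (L + 1)) DyckStep.U ++
    ((X a L).toList ++ (X a L).toList)) (List.replicate (a (L + 1)) DyckStep.D) i
  have h' := height_append_right (List.replicate (a (L + 1)) DyckStep.U)
    ((X a L).toList ++ (X a L).toList) (len a L + len a L)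
  have h'' := height_append_right (X a L).toList (X a L).toList (len a L)
  have hl := height_length (X a L)
  simp only [List.length_replicate, List.length_append, height_replicate_U le_rfl,
    height_replicate_D hi] at h h' h''
  simp only [len] at h' h'' ⊢
  rw [toList_X_succ, show ∀ b n : ℕ, b + n + n + i = b + (n + n) + i by intros; omega, h, h', h'',
    hl]
  ring

/-- The greatest height of `X(a₀, …, a_L)`. -/
def total (a : ℕ → ℕ) (L : ℕ) : ℕ := ∑ i ∈ Finset.range (L + 1), a i

lemma total_succ (a : ℕ → ℕ) (L : ℕ) : total a (L + 1) = total a L + a (L + 1) :=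
  Finset.sum_range_succ _ _

lemma height_X_le (a : ℕ → ℕ) (L : ℕ) {x : ℕ} (hx : x ≤ len a L) :
    height (X a L).toList x ≤ total a L := by
  induction L generalizing x with
  | zero =>
    rw [len_zero] at hx
    rw [toList_X_zero, List.append_nil]
    rcases le_total x (a 0) with h | h
    · rw [height_append_left _ _ (by simpa), height_replicate_U h]
      simpa [total] using h
    · obtain ⟨i, rfl⟩ := Nat.exists_eq_add_of_le h
      have h' := height_append_right (List.replicate (a 0) DyckStep.U)
        (List.replicate (a 0) DyckStep.D) i
      rw [List.length_replicate, height_replicate_U le_rfl, height_replicate_D (by omega)] at h'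
      rw [h']
      simp [total]
  | succ L ih =>
    rw [len_succ] at hx
    rw [total_succ]
    push_cast
    rcases le_total x (a (L + 1)) with h1 | h1
    · rw [height_X_prefix a L h1]
      omega
    obtain ⟨i, rfl⟩ := Nat.exists_eq_add_of_le h1
    rcases le_total i (len a L) with h2 | h2
    · rw [height_X_fst a L h2]
      linarith [ih h2]
    obtain ⟨j, rfl⟩ := Nat.exists_eq_add_of_le h2
    rw [← add_assoc]
    rcases le_total j (len a L) with h3 | h3
    · rw [height_X_snd a L h3]
      linarith [ih h3]
    obtain ⟨k, rfl⟩ := Nat.exists_eq_add_of_le h3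
    rw [← add_assoc, height_X_suffix a L (by omega)]
    omega

/-! ### Subtrees inside a height profile -/

/-- The function `h` has the shape of the heights of `X(a₀, …, a_L)` from the position `p` on. -/
def Occurs (a : ℕ → ℕ) (h : ℕ → ℤ) (L p : ℕ) : Prop :=
  ∀ i ≤ len a L, h (p + i) = h p + height (X a L).toList i

namespace Occurs

variable {a : ℕ → ℕ} {h : ℕ → ℤ} {L p : ℕ}

lemma le (H : Occurs a h L p) {x : ℕ} (h1 : p ≤ x) (h2 : x ≤ p + len a L) : h p ≤ h x := by
  obtain ⟨i, rfl⟩ := Nat.exists_eq_add_of_le h1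
  rw [H i (by omega)]
  linarith [height_nonneg (X a L) i]

lemma le_add_total (H : Occurs a h L p) {x : ℕ} (h1 : p ≤ x) (h2 : x ≤ p + len a L) :
    h x ≤ h p + total a L := by
  obtain ⟨i, rfl⟩ := Nat.exists_eq_add_of_le h1
  rw [H i (by omega)]
  linarith [height_X_le a L (x := i) (by omega)]

lemma height_end (H : Occurs a h L p) : h (p + len a L) = h p := by
  rw [H _ le_rfl, len, height_length, add_zero]

lemma height_fst (H : Occurs a h (L + 1) p) : h (p + a (L + 1)) = h p + a (L + 1) := by
  rw [H _ (by rw [len_succ]; omega), height_X_prefix a L le_rfl]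

lemma fst (H : Occurs a h (L + 1) p) : Occurs a h L (p + a (L + 1)) := fun i hi => by
  rw [H.height_fst, add_assoc, H _ (by rw [len_succ]; omega), height_X_fst a L hi]
  ring

lemma height_snd (H : Occurs a h (L + 1) p) :
    h (p + a (L + 1) + len a L) = h p + a (L + 1) := by
  rw [H.fst.height_end, H.height_fst]

lemma snd (H : Occurs a h (L + 1) p) : Occurs a h L (p + a (L + 1) + len a L) := fun i hi => by
  rw [H.height_snd, add_assoc, add_assoc, ← add_assoc (a (L + 1)),
    H _ (by rw [len_succ]; omega), height_X_snd a L hi]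
  ring

lemma height_inner_ge (H : Occurs a h (L + 1) p) {x : ℕ} (h1 : p + a (L + 1) ≤ x)
    (h2 : x ≤ p + a (L + 1) + len a L + len a L) : h p + a (L + 1) ≤ h x := by
  rcases le_total x (p + a (L + 1) + len a L) with h3 | h3
  · rw [← H.height_fst]
    exact H.fst.le h1 h3
  · rw [← H.height_snd]
    exact H.snd.le h3 h2

/-- The `2 ^ d` disjoint subtrees `d` levels below the root. -/
lemma descend {d : ℕ} (h0 : 0 < len a L) (H : Occurs a h (L + d) p) :
    ∃ Q : Finset ℕ, Q.card = 2 ^ d ∧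
    (∀ q ∈ Q, Occurs a h L q ∧ p ≤ q ∧ q + len a L ≤ p + len a (L + d)) ∧
    ∀ q ∈ Q, ∀ q' ∈ Q, q < q' → q + len a L ≤ q' := by
  induction d generalizing p with
  | zero => exact ⟨{p}, by simp, by simpa using H, by simp⟩
  | succ d ih =>
    rw [← add_assoc] at H ⊢
    obtain ⟨Q₁, c₁, h₁, s₁⟩ := ih H.fst
    obtain ⟨Q₂, c₂, h₂, s₂⟩ := ih H.snd
    rw [len_succ]
    refine ⟨Q₁ ∪ Q₂, ?_, ?_, ?_⟩
    · rw [Finset.card_union_of_disjoint, c₁, c₂, pow_succ, mul_two]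
      rw [Finset.disjoint_left]
      intro q hq hq'
      have := h₁ q hq
      have := h₂ q hq'
      omega
    · intro q hq
      rcases Finset.mem_union.1 hq with hq | hq
      · obtain ⟨o, _, _⟩ := h₁ q hq
        exact ⟨o, by omega, by omega⟩
      · obtain ⟨o, _, _⟩ := h₂ q hq
        exact ⟨o, by omega, by omega⟩
    · intro q hq q' hq' hlt
      rcases Finset.mem_union.1 hq with hq | hq <;> rcases Finset.mem_union.1 hq' with hq' | hq'
      · exact s₁ q hq q' hq' hlt
      · have := h₁ q hq
        have := h₂ q' hq'
        omega
      · have := h₂ q hq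
        have := h₁ q' hq'
        omega
      · exact s₂ q hq q' hq' hlt

end Occurs

/-! ### Maximal runs of a finite set -/

/-- The first elements of the maximal runs of consecutive integers in `E ∩ [l, r)`. -/
def starts (E : Finset ℕ) (l r : ℕ) : Finset ℕ :=
  (Finset.Ico l r).filter fun b => b ∈ E ∧ (b = l ∨ b - 1 ∉ E)

/-- The last elements of the maximal runs of consecutive integers in `E`. -/
def ends (E : Finset ℕ) : Finset ℕ := E.filter fun b => b + 1 ∉ E

/-- The number of maximal runs of consecutive integers in `E ∩ [l, r)`. -/
def runs (E : Finset ℕ) (l r : ℕ) : ℕ := (starts E l r).card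

lemma mem_starts {E : Finset ℕ} {l r b : ℕ} :
    b ∈ starts E l r ↔ (l ≤ b ∧ b < r) ∧ b ∈ E ∧ (b = l ∨ b - 1 ∉ E) := by
  simp [starts]

lemma exists_start {E : Finset ℕ} {b c : ℕ} (hb : b ∈ E) (hc : c ∉ E) (h : c < b) :
    ∃ e, c < e ∧ e ≤ b ∧ e ∈ E ∧ e - 1 ∉ E := by
  induction b with
  | zero => omega
  | succ b ih =>
    by_cases hbE : b ∈ E
    · have : c ≠ b := fun e => hc (e ▸ hbE)
      obtain ⟨e, h1, h2, h3⟩ := ih hbE (by omega)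
      exact ⟨e, h1, by omega, h3⟩
    · exact ⟨b + 1, h, le_rfl, hb, by simpa⟩

lemma exists_end {E : Finset ℕ} {b c : ℕ} (hb : b ∈ E) (hc : c ∉ E) (h : b < c) :
    ∃ e, b ≤ e ∧ e < c ∧ e ∈ ends E := by
  induction c with
  | zero => omega
  | succ c ih =>
    by_cases hcE : c ∈ E
    · exact ⟨c, by omega, by omega, Finset.mem_filter.2 ⟨hcE, hc⟩⟩
    · have : b ≠ c := fun e => hcE (e ▸ hb)
      obtain ⟨e, h1, h2, h3⟩ := ih hcE (by omega)
      exact ⟨e, h1, by omega, h3⟩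

lemma exists_run_right (E : Finset ℕ) {m r : ℕ} (h : m ≤ r) :
    ∃ y, m ≤ y ∧ y ≤ r ∧ (∀ b, m ≤ b → b < y → b ∈ E) ∧ (y < r → y ∉ E) := by
  induction r, h using Nat.le_induction with
  | base => exact ⟨m, le_rfl, le_rfl, by omega, by omega⟩
  | succ r h ih =>
    obtain ⟨y, h1, h2, h3, h4⟩ := ih
    rcases h2.lt_or_eq with h2 | rfl
    · exact ⟨y, h1, by omega, h3, fun _ => h4 h2⟩
    by_cases hy : y ∈ E
    · refine ⟨y + 1, by omega, le_rfl, fun b hb hb' => ?_, by omega⟩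
      rcases (Nat.lt_succ_iff.1 hb').lt_or_eq with h | rfl
      · exact h3 b hb h
      · exact hy
    · exact ⟨y, h1, by omega, h3, fun _ => hy⟩

lemma exists_run_left (E : Finset ℕ) {l m : ℕ} (h : l ≤ m) :
    ∃ x, l ≤ x ∧ x ≤ m ∧ (∀ b, x ≤ b → b < m → b ∈ E) ∧ (l < x → x - 1 ∉ E) := by
  induction m, h using Nat.le_induction with
  | base => exact ⟨l, le_rfl, le_rfl, by omega, by omega⟩
  | succ m h ih =>
    obtain ⟨x, h1, h2, h3, h4⟩ := ih
    by_cases hm : m ∈ E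
    · refine ⟨x, h1, by omega, fun b hb hb' => ?_, h4⟩
      rcases (Nat.lt_succ_iff.1 hb').lt_or_eq with h | rfl
      · exact h3 b hb h
      · exact hm
    · exact ⟨m + 1, by omega, le_rfl, by omega, fun _ => by simpa⟩

lemma runs_mono_right (E : Finset ℕ) (l : ℕ) {r r' : ℕ} (h : r ≤ r') :
    runs E l r ≤ runs E l r' :=
  Finset.card_le_card fun b hb => by
    rw [mem_starts] at hb ⊢
    exact ⟨⟨hb.1.1, by omega⟩, hb.2⟩

lemma runs_pos {E : Finset ℕ} {l r b : ℕ} (hb : b ∈ E) (h1 : l ≤ b) (h2 : b < r) :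
    0 < runs E l r := by
  rw [runs, Finset.card_pos]
  by_cases hl : l ∈ E
  · exact ⟨l, mem_starts.2 ⟨⟨le_rfl, by omega⟩, hl, Or.inl rfl⟩⟩
  · have : l ≠ b := fun e => hl (e ▸ hb)
    obtain ⟨e, h3, h4, h5, h6⟩ := exists_start hb hl (by omega)
    exact ⟨e, mem_starts.2 ⟨⟨by omega, by omega⟩, h5, Or.inr h6⟩⟩

/-- Only a run crossing `m` is counted twice, its second part starting at `m`. -/
lemma runs_add_le (E : Finset ℕ) {l m r : ℕ} (h1 : l ≤ m) (h2 : m ≤ r) :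
    runs E l m + runs E m r ≤ runs E l r + 1 := by
  have hsub : starts E l m ∪ (starts E m r).erase m ⊆ starts E l r := by
    intro b hb
    simp only [Finset.mem_union, Finset.mem_erase, mem_starts] at hb
    rw [mem_starts]
    rcases hb with hb | hb
    · exact ⟨⟨by omega, by omega⟩, hb.2⟩
    · exact ⟨⟨by omega, by omega⟩, hb.2.2.1, Or.inr (hb.2.2.2.resolve_left hb.1)⟩
  have hdisj : Disjoint (starts E l m) ((starts E m r).erase m) := by
    rw [Finset.disjoint_left]
    intro b hb hb'
    simp only [Finset.mem_erase, mem_starts] at hb hb'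
    omega
  have h := Finset.card_le_card hsub
  rw [Finset.card_union_of_disjoint hdisj] at h
  have := Finset.pred_card_le_card_erase (s := starts E m r) (a := m)
  simp only [runs]
  omega

lemma runs_add_le_of_notMem (E : Finset ℕ) {l m r : ℕ} (h1 : l < m) (h2 : m ≤ r)
    (hm : m - 1 ∉ E) : runs E l m + runs E m r ≤ runs E l r := by
  have hsub : starts E l m ∪ starts E m r ⊆ starts E l r := by
    intro b hb
    simp only [Finset.mem_union, mem_starts] at hb
    rw [mem_starts]
    rcases hb with hb | hb
    · exact ⟨⟨by omega, by omega⟩, hb.2⟩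
    · refine ⟨⟨by omega, by omega⟩, hb.2.1, Or.inr ?_⟩
      rcases hb.2.2 with rfl | h
      · exact hm
      · exact h
  have hdisj : Disjoint (starts E l m) (starts E m r) := by
    rw [Finset.disjoint_left]
    intro b hb hb'
    simp only [mem_starts] at hb hb'
    omega
  have h := Finset.card_le_card hsub
  rwa [Finset.card_union_of_disjoint hdisj] at h

/-- The sets of starts need not be nested: truncation can create a start at `m`. Then `m - 1` is
erased, and a run of `[l, m)` pays for it. -/
lemma runs_mono_left (E : Finset ℕ) {l m r : ℕ} (h1 : l ≤ m) (h2 : m ≤ r) :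
    runs E m r ≤ runs E l r := by
  rcases h1.eq_or_lt with rfl | h1
  · exact le_rfl
  by_cases hm : m - 1 ∈ E
  · have := runs_add_le E h1.le h2
    have := runs_pos hm (show l ≤ m - 1 by omega) (show m - 1 < m by omega)
    omega
  · have := runs_add_le_of_notMem E h1 h2 hm
    omega

lemma runs_mono (E : Finset ℕ) {l l' r' r : ℕ} (h1 : l ≤ l') (h2 : l' ≤ r') (h3 : r' ≤ r) :
    runs E l' r' ≤ runs E l r :=
  (runs_mono_left E h1 h2).trans (runs_mono_right E l h3)

/-- The gap `c` separates the run of `b` from every run that meets `[l', r')`. -/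
lemma runs_lt_of_gap_left {E : Finset ℕ} {l l' r' r b c : ℕ} (hb : b ∈ E) (hc : c ∉ E)
    (h1 : l ≤ b) (h2 : b < c) (h3 : c < l') (h4 : l' ≤ r') (h5 : r' ≤ r) :
    runs E l' r' < runs E l r := by
  have hr := runs_mono_right E l' h5
  by_cases hm : l' - 1 ∈ E
  -- A run may cross `l'` and be counted twice, but then `[l, l')` has two runs, one on each side of
  -- `c`.
  · have := runs_add_le E (show l ≤ l' by omega) (h4.trans h5)
    have := runs_add_le_of_notMem E (show l < c + 1 by omega) (show c + 1 ≤ l' by omega)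
      (by simpa)
    have := runs_pos hb h1 (show b < c + 1 by omega)
    have : c ≠ l' - 1 := fun e => hc (e ▸ hm)
    have := runs_pos hm (show c + 1 ≤ l' - 1 by omega) (show l' - 1 < l' by omega)
    omega
  · have := runs_add_le_of_notMem E (show l < l' by omega) (h4.trans h5) hm
    have := runs_pos hb h1 (show b < l' by omega)
    omega

lemma runs_lt_of_gap_right {E : Finset ℕ} {l l' r' r b c : ℕ} (hb : b ∈ E) (hc : c ∉ E)
    (h1 : l ≤ l') (h2 : l' ≤ r') (h3 : r' ≤ c) (h4 : c < b) (h5 : b < r) :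
    runs E l' r' < runs E l r := by
  have := runs_add_le_of_notMem E (show l < c + 1 by omega) (show c + 1 ≤ r by omega) (by simpa)
  have := runs_pos hb (show c + 1 ≤ b by omega) h5
  have := runs_mono E h1 h2 (show r' ≤ c + 1 by omega)
  omega

/-- Disjoint intervals that all meet a finite set are at most as many as its elements. -/
lemma card_le_of_disjoint_intervals {Q F : Finset ℕ} {n : ℕ}
    (hQ : ∀ q ∈ Q, ∀ q' ∈ Q, q < q' → q + n ≤ q')
    (hF : ∀ q ∈ Q, ∃ e ∈ F, q ≤ e ∧ e < q + n) : Q.card ≤ F.card := by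
  choose! e he using hF
  refine Finset.card_le_card_of_injOn e (fun q hq => (he q hq).1) fun q hq q' hq' h => ?_
  have h1 := he q hq
  have h2 := he q' hq'
  rcases lt_trichotomy q q' with h3 | h3 | h3
  · have := hQ q hq q' hq' h3
    omega
  · exact h3
  · have := hQ q' hq' q hq h3
    omega

lemma card_increase_le {g : ℕ → ℤ} (hg : Monotone g) {s t : ℕ} (h : s ≤ t) :
    (((Finset.Ico s t).filter fun i => g i < g (i + 1)).card : ℤ) ≤ g t - g s := by
  induction t, h using Nat.le_induction with
  | base => simp
  | succ t h ih =>
    have hins : Finset.Ico s (t + 1) = insert t (Finset.Ico s t) := by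
      ext b
      simp only [Finset.mem_insert, Finset.mem_Ico]
      omega
    rw [hins, Finset.filter_insert]
    have := hg (Nat.le_succ t)
    split_ifs with hlt
    · rw [Finset.card_insert_of_notMem (by simp)]
      push_cast
      simp only [Nat.succ_eq_add_one] at *
      omega
    · simp only [Nat.succ_eq_add_one] at *
      omega

/-! ### Flow through cuts -/

/-- The course of a re-pairing of a word with heights `h` and length `N`: the set of the erased
positions at each time, and the number `flow t x` of the pairs erased before the time `t` that
cross the cut in front of the position `x`. -/
structure Play (h : ℕ → ℤ) (N : ℕ) where
  erased : ℕ → Finset ℕ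
  flow : ℕ → ℕ → ℤ
  erased_mono : Monotone erased
  flow_mono : ∀ x, Monotone fun t => flow t x
  flow_nonneg : ∀ t x, 0 ≤ flow t x
  flow_succ : ∀ t x, x < N →
    flow t (x + 1) = flow t x + if x ∈ erased t then h (x + 1) - h x else 0
  card_step : ∀ t, (erased (t + 1) \ erased t).card ≤ 2

namespace Play

variable {h : ℕ → ℤ} {N : ℕ} (P : Play h N)

lemma flow_eq_of_empty {t x y : ℕ} (hxy : x ≤ y) (hy : y ≤ N)
    (hE : ∀ b, x ≤ b → b < y → b ∉ P.erased t) : P.flow t y = P.flow t x := by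
  induction y, hxy using Nat.le_induction with
  | base => rfl
  | succ y hxy ih =>
    rw [P.flow_succ t y (by omega), if_neg (hE y hxy (by omega)), add_zero,
      ih (by omega) fun b h1 h2 => hE b h1 (by omega)]

lemma flow_eq_of_full {t x y : ℕ} (hxy : x ≤ y) (hy : y ≤ N)
    (hE : ∀ b, x ≤ b → b < y → b ∈ P.erased t) : P.flow t y = P.flow t x + (h y - h x) := by
  induction y, hxy using Nat.le_induction with
  | base => simp
  | succ y hxy ih =>
    rw [P.flow_succ t y (by omega), if_pos (hE y hxy (by omega)),
      ih (by omega) fun b h1 h2 => hE b h1 (by omega)]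
    ring

/-- Each run of erased positions changes the flow by at most the oscillation of the height. -/
lemma flow_change_le {F k : ℕ → ℤ} {E : Finset ℕ} {l r : ℕ} {lo H : ℤ} (hlr : l ≤ r)
    (hF : ∀ x, l ≤ x → x < r → F (x + 1) = F x + if x ∈ E then k (x + 1) - k x else 0)
    (hlo : ∀ x, l ≤ x → x ≤ r → lo ≤ k x) (hhi : ∀ x, l ≤ x → x ≤ r → k x ≤ lo + H) :
    F r ≤ F l + runs E l r * H := by
  have hH : 0 ≤ H := by linarith [hlo l le_rfl hlr, hhi l le_rfl hlr]
  -- Strengthened for the induction: a run still open at `r` has used at most `k r - lo` of its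
  -- allowance `H`, so it may continue at no new charge.
  suffices hs : F r ≤ F l + runs E l r * H -
      if l < r ∧ r - 1 ∈ E then lo + H - k r else 0 by
    have := hhi r hlr le_rfl
    split_ifs at hs <;> linarith
  induction r, hlr using Nat.le_induction with
  | base => simp [runs, starts]
  | succ r hlr ih =>
    have ih := ih (fun x h1 h2 => hF x h1 (by omega)) (fun x h1 h2 => hlo x h1 (by omega))
      (fun x h1 h2 => hhi x h1 (by omega))
    have h1 := hlo r hlr (by omega)
    have h2 := hhi r hlr (by omega)
    have h3 := hlo (r + 1) (by omega) le_rfl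
    have hmono : (runs E l r : ℤ) * H ≤ runs E l (r + 1) * H := by
      have : (runs E l r : ℤ) ≤ runs E l (r + 1) := by
        exact_mod_cast runs_mono_right E l (Nat.le_succ r)
      exact mul_le_mul_of_nonneg_right this hH
    rw [hF r hlr (by omega)]
    by_cases hr : r ∈ E
    · rw [if_pos hr, if_pos ⟨by omega, by simpa⟩]
      by_cases hin : l < r ∧ r - 1 ∈ E
      · rw [if_pos hin] at ih
        linarith
      · rw [if_neg hin] at ih
        have hst : starts E l (r + 1) = insert r (starts E l r) := by
          ext b
          simp only [Finset.mem_insert, mem_starts]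
          constructor
          · rintro ⟨⟨h4, h5⟩, h6⟩
            rcases (Nat.lt_succ_iff.1 h5).eq_or_lt with h7 | h7
            · exact Or.inl h7
            · exact Or.inr ⟨⟨h4, h7⟩, h6⟩
          · rintro (rfl | ⟨⟨h4, h5⟩, h6⟩)
            · refine ⟨⟨hlr, by omega⟩, hr, ?_⟩
              by_cases hlb : b = l
              · exact Or.inl hlb
              · exact Or.inr fun hb => hin ⟨by omega, hb⟩
            · exact ⟨⟨h4, by omega⟩, h6⟩
        have hc : runs E l (r + 1) = runs E l r + 1 := by
          rw [runs, hst, Finset.card_insert_of_notMem (by simp [mem_starts]), runs]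
        rw [hc]
        push_cast
        linarith
    · rw [if_neg hr, if_neg (by simpa using fun _ => hr)]
      split_ifs at ih <;> linarith

lemma abs_flow_sub_le (t : ℕ) {l r : ℕ} {lo H : ℤ} (hlr : l ≤ r) (hr : r ≤ N)
    (hlo : ∀ x, l ≤ x → x ≤ r → lo ≤ h x) (hhi : ∀ x, l ≤ x → x ≤ r → h x ≤ lo + H) :
    |P.flow t r - P.flow t l| ≤ runs (P.erased t) l r * H := by
  rw [abs_le]
  constructor
  -- The lower bound is the upper bound for the negated flow and height.
  · have := flow_change_le (F := fun x => -P.flow t x) (k := fun x => -h x) (E := P.erased t)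
      (lo := -(lo + H)) (H := H) hlr (fun x _ h2 => ?_) (fun x h1 h2 => ?_) (fun x h1 h2 => ?_)
    · linarith
    · rw [P.flow_succ t x (by omega)]
      split_ifs <;> ring
    · linarith [hhi x h1 h2]
    · linarith [hlo x h1 h2]
  · linarith [flow_change_le hlr (fun x _ h2 => P.flow_succ t x (by omega)) hlo hhi]

/-- If all erased runs of `[l, r)` meet `[l', r')`, and an erased run comes from the left across
the valley `z`, then it leaves the hill to the right of `[l', r')` as well. -/
lemma full_of_valley_left {l z l' r' m r b s₀ s : ℕ} {H W : ℤ} (hs : s₀ ≤ s)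
    (hr : P.flow s r = P.flow s₀ r) (hN : r ≤ N) (hzl : z ≤ l') (hlr' : l' ≤ r')
    (hmr : m ≤ r) (hrm : r' ≤ m) (hlb : l ≤ b) (hbz : b < z) (hb : b ∈ P.erased s)
    (hempty : ∀ c, z ≤ c → c < m → c ∉ P.erased s₀)
    (hruns : runs (P.erased s) l r ≤ runs (P.erased s) l' r')
    (hh : h r' = h l') (hlo : ∀ x, l' ≤ x → x ≤ r' → h l' ≤ h x)
    (hhi : ∀ x, l' ≤ x → x ≤ r' → h x ≤ h l' + H)
    (hW : ∀ x, r' ≤ x → x ≤ m → h z + W ≤ h x)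
    (hHW : runs (P.erased s) l' r' * H < W) :
    ∀ c, r' ≤ c → c < m → c ∈ P.erased s := by
  -- Here `y` is the first unerased position from `r'` on, capped at `r`.
  obtain ⟨y, hy1, hy2, hy3, hy4⟩ := exists_run_right (P.erased s) (hrm.trans hmr)
  by_contra! hcon
  obtain ⟨c, hc1, hc2, hc3⟩ := hcon
  have hym : y < m := lt_of_le_of_lt (not_lt.1 fun hlt => hc3 (hy3 c hc1 hlt)) hc2
  have hyE := hy4 (by omega)
  have hleft : ∀ c, z ≤ c → c < l' → c ∈ P.erased s := by
    intro c h1 h2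
    by_contra hc
    exact hruns.not_gt (runs_lt_of_gap_left hb hc hlb (by omega) h2 hlr' (by omega))
  have hright : ∀ c, y ≤ c → c < r → c ∉ P.erased s := by
    intro c h1 h2 hc
    have : y ≠ c := fun e => hyE (e ▸ hc)
    exact hruns.not_gt (runs_lt_of_gap_right hc hyE (by omega) hlr' hy1 (by omega) h2)
  -- If the run stopped at `y` on the hill, the flow at `y` would exceed that at `z` by at least `W`
  -- minus the loss inside `[l', r')`, hence strictly. Yet it equals the unchanged flow at `r`,
  -- which at time `s₀` was also the flow at `z`, and the flow at `z` has not dropped since.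
  have e1 := P.flow_eq_of_full hzl (by omega) hleft
  have e2 := abs_le.1 (P.abs_flow_sub_le s hlr' (by omega) hlo hhi)
  have e3 := P.flow_eq_of_full hy1 (by omega) hy3
  have e4 := P.flow_eq_of_empty hy2 hN hright
  have e5 := P.flow_eq_of_empty (t := s₀) hy2 hN fun c h1 h2 hc =>
    hright c h1 h2 (P.erased_mono hs hc)
  have e6 := P.flow_eq_of_empty (t := s₀) (x := z) (y := y) (by omega) (by omega) fun c h1 h2 =>
    hempty c h1 (by omega)
  have e7 := P.flow_mono z hs
  have e8 := hW y hy1 hym.le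
  simp only at e7
  linarith [e2.1]

/-- Mirror image of `full_of_valley_left`: the run comes from the right of `z`, and the fixed flow
is the one at `l`. -/
lemma full_of_valley_right {l m l' r' z r b s₀ s : ℕ} {H W : ℤ} (hs : s₀ ≤ s)
    (hl : P.flow s l = P.flow s₀ l) (hN : r ≤ N) (hzl : r' ≤ z) (hlr' : l' ≤ r')
    (hmr : l ≤ m) (hrm : m ≤ l') (hzb : z ≤ b) (hbr : b < r) (hb : b ∈ P.erased s)
    (hempty : ∀ c, m ≤ c → c < z → c ∉ P.erased s₀)
    (hruns : runs (P.erased s) l r ≤ runs (P.erased s) l' r')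
    (hh : h r' = h l') (hlo : ∀ x, l' ≤ x → x ≤ r' → h l' ≤ h x)
    (hhi : ∀ x, l' ≤ x → x ≤ r' → h x ≤ h l' + H)
    (hW : ∀ x, m ≤ x → x ≤ l' → h z + W ≤ h x)
    (hHW : runs (P.erased s) l' r' * H < W) :
    ∀ c, m ≤ c → c < l' → c ∈ P.erased s := by
  obtain ⟨x, hx1, hx2, hx3, hx4⟩ := exists_run_left (P.erased s) (hmr.trans hrm)
  by_contra! hcon
  obtain ⟨c, hc1, hc2, hc3⟩ := hcon
  have hxm : m < x := lt_of_le_of_lt hc1 (not_le.1 fun hle => hc3 (hx3 c hle hc2))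
  have hxE := hx4 (by omega)
  have hright : ∀ c, r' ≤ c → c < z → c ∈ P.erased s := by
    intro c h1 h2
    by_contra hc
    exact hruns.not_gt (runs_lt_of_gap_right hb hc (by omega) hlr' h1 (by omega) hbr)
  have hleft : ∀ c, l ≤ c → c < x → c ∉ P.erased s := by
    intro c h1 h2 hc
    have : x - 1 ≠ c := fun e => hxE (e ▸ hc)
    exact hruns.not_gt (runs_lt_of_gap_left hc hxE h1 (by omega) (by omega) hlr' (by omega))
  have e1 := P.flow_eq_of_full hzl (by omega) hright
  have e2 := abs_le.1 (P.abs_flow_sub_le s hlr' (by omega) hlo hhi)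
  have e3 := P.flow_eq_of_full hx2 (by omega) hx3
  have e4 := P.flow_eq_of_empty hx1 (by omega) hleft
  have e5 := P.flow_eq_of_empty (t := s₀) hx1 (by omega) fun c h1 h2 hc =>
    hleft c h1 h2 (P.erased_mono hs hc)
  have e6 := P.flow_eq_of_empty (t := s₀) (x := x) (y := z) (by omega) (by omega) fun c h1 h2 =>
    hempty c (by omega) h2
  have e7 := P.flow_mono z hs
  have e8 := hW x hxm.le hx2
  simp only at e7
  linarith [e2.2]

/-- Among many disjoint intervals, one is erased while no pair crosses two given cuts. -/
lemma exists_quiet_interval {Q : Finset ℕ} {n l r s₀ s₁ w H : ℕ} (hn : 0 < n) (hs : s₀ ≤ s₁)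
    (hQ : ∀ q ∈ Q, ∀ q' ∈ Q, q < q' → q + n ≤ q') (hQN : ∀ q ∈ Q, q + n ≤ N)
    (hempty : ∀ q ∈ Q, ∀ b, q ≤ b → b < q + n → b ∉ P.erased s₀)
    (hfull : ∀ q ∈ Q, ∀ b, q ≤ b → b < q + n → b ∈ P.erased s₁)
    (hH : ∀ t, P.flow t l ≤ H ∧ P.flow t r ≤ H)
    (hw : ∀ t, runs (P.erased t) 0 N ≤ w ∧ (ends (P.erased t)).card ≤ w)
    (hcard : 2 * H * (2 * w + 2) < Q.card) :
    ∃ q ∈ Q, ∃ u v, s₀ ≤ u ∧ u ≤ v ∧ v ≤ s₁ ∧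
      (∀ b, q ≤ b → b < q + n → b ∉ P.erased u) ∧ (∀ b, q ≤ b → b < q + n → b ∈ P.erased v) ∧
      P.flow u l = P.flow v l ∧ P.flow u r = P.flow v r := by
  classical
  set g : ℕ → ℤ := fun t => P.flow t l + P.flow t r with hg
  have hgm : Monotone g := fun s t hst => add_le_add (P.flow_mono l hst) (P.flow_mono r hst)
  set S := (Finset.Ico s₀ s₁).filter fun i => g i < g (i + 1) with hS
  -- Each of the two flows stays between `0` and `H`.
  have hScard : S.card ≤ 2 * H := by
    have h1 := card_increase_le hgm hs
    have h2 := hH s₁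
    have h3 := P.flow_nonneg s₀ l
    have h4 := P.flow_nonneg s₀ r
    simp only [hg] at h1
    have : (S.card : ℤ) ≤ 2 * H := by linarith
    exact_mod_cast this
  -- The intervals caught in mid-erasure by step `s`: touched after it, unfinished before it.
  set K : ℕ → Finset ℕ := fun s => Q.filter fun q =>
    (∃ b, q ≤ b ∧ b < q + n ∧ b ∈ P.erased (s + 1)) ∧
      ∃ b, q ≤ b ∧ b < q + n ∧ b ∉ P.erased s with hK
  have hKcard : ∀ s, (K s).card ≤ 2 * w + 2 := by
    intro s
    -- Every such interval contains a boundary of a run or a newly erased position: at most `w`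
    -- starts, `w` ends and `2` new positions.
    set F := starts (P.erased s) 0 N ∪ ends (P.erased s) ∪ (P.erased (s + 1) \ P.erased s) with hF
    have hFcard : F.card ≤ 2 * w + 2 := by
      have h1 := Finset.card_union_le (starts (P.erased s) 0 N ∪ ends (P.erased s))
        (P.erased (s + 1) \ P.erased s)
      have h2 := Finset.card_union_le (starts (P.erased s) 0 N) (ends (P.erased s))
      have h3 := P.card_step s
      have h4 := hw s
      simp only [runs] at h4
      rw [hF]
      omega
    refine le_trans (card_le_of_disjoint_intervals (F := F) (n := n)
      (fun q hq q' hq' => hQ q (Finset.filter_subset _ _ hq) q' (Finset.filter_subset _ _ hq'))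
      fun q hq => ?_) hFcard
    obtain ⟨hqQ, ⟨b, hb1, hb2, hb3⟩, c, hc1, hc2, hc3⟩ := Finset.mem_filter.1 hq
    simp only [hF, Finset.mem_union, Finset.mem_sdiff]
    by_cases hbs : b ∈ P.erased s
    · rcases lt_trichotomy b c with hlt | rfl | hlt
      · obtain ⟨e, h1, h2, h3⟩ := exists_end hbs hc3 hlt
        exact ⟨e, Or.inl (Or.inr h3), by omega, by omega⟩
      · exact absurd hbs hc3
      · obtain ⟨e, h1, h2, h3, h4⟩ := exists_start hbs hc3 hlt
        have := hQN q hqQ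
        exact ⟨e, Or.inl (Or.inl (mem_starts.2 ⟨⟨by omega, by omega⟩, h3, Or.inr h4⟩)),
          by omega, by omega⟩
    · exact ⟨b, Or.inr ⟨hb3, hbs⟩, hb1, hb2⟩
  have hex : ∃ q ∈ Q, q ∉ S.biUnion K := by
    by_contra! hcon
    have h1 := Finset.card_le_card hcon
    have h2 : (S.biUnion K).card ≤ S.card * (2 * w + 2) :=
      Finset.card_biUnion_le_card_mul _ _ _ fun s _ => hKcard s
    have h3 := Nat.mul_le_mul_right (2 * w + 2) hScard
    omega
  obtain ⟨q, hqQ, hqK⟩ := hex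
  have hne : ∃ t, ∃ b, q ≤ b ∧ b < q + n ∧ b ∈ P.erased t :=
    ⟨s₁, q, le_rfl, by omega, hfull q hqQ q le_rfl (by omega)⟩
  have hfl : ∃ t, ∀ b, q ≤ b → b < q + n → b ∈ P.erased t := ⟨s₁, hfull q hqQ⟩
  -- The period runs from the last untouched time `Nat.find hne - 1` to the first time the interval
  -- is fully erased. Throughout it the interval is in mid-erasure, so avoiding all `K t` with `t ∈
  -- S` makes `g` constant, and with it both monotone flows.
  obtain ⟨b₀, hb1, hb2, hb3⟩ := Nat.find_spec hne
  have hlt : s₀ < Nat.find hne := by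
    by_contra! hle
    exact hempty q hqQ b₀ hb1 hb2 (P.erased_mono hle hb3)
  have hu : ∀ b, q ≤ b → b < q + n → b ∉ P.erased (Nat.find hne - 1) := by
    intro b h1 h2 h3
    exact Nat.find_min hne (m := Nat.find hne - 1) (by omega) ⟨b, h1, h2, h3⟩
  have huv : Nat.find hne - 1 ≤ Nat.find hfl := by
    by_contra! hle
    exact hu q le_rfl (by omega) (P.erased_mono hle.le (Nat.find_spec hfl q le_rfl (by omega)))
  have hv : Nat.find hfl ≤ s₁ := Nat.find_min' hfl (hfull q hqQ)
  have hconst : ∀ t, Nat.find hne - 1 ≤ t → t ≤ Nat.find hfl → g t = g (Nat.find hne - 1) := by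
    intro t ht
    induction t, ht using Nat.le_induction with
    | base => intro _; rfl
    | succ t ht ih =>
      intro ht'
      rw [← ih (by omega)]
      by_contra hgt
      refine hqK (Finset.mem_biUnion.2 ⟨t, Finset.mem_filter.2 ⟨Finset.mem_Ico.2
        ⟨by omega, by omega⟩, lt_of_le_of_ne (hgm (Nat.le_succ t)) (Ne.symm hgt)⟩,
        Finset.mem_filter.2 ⟨hqQ, ⟨b₀, hb1, hb2, P.erased_mono (by omega) hb3⟩, ?_⟩⟩)
      have := Nat.find_min hfl (m := t) (by omega)
      push Not at this
      exact this
  have hgeq := hconst _ huv le_rfl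
  have m1 := P.flow_mono l huv
  have m2 := P.flow_mono r huv
  simp only [hg] at hgeq m1 m2
  exact ⟨q, hqQ, _, _, by omega, huv, hv, hu, Nat.find_spec hfl, by linarith, by linarith⟩

end Play

/-! ### The recursion that gains one run per round -/

lemma len_pos {a : ℕ → ℕ} (ha : ∀ i, 0 < a i) (L : ℕ) : 0 < len a L := by
  cases L with
  | zero => rw [len_zero]; linarith [ha 0]
  | succ L => rw [len_succ]; linarith [ha (L + 1), Nat.zero_le (len a L)]

namespace Play

variable {h : ℕ → ℤ} {N : ℕ} (P : Play h N)

/-- One of four small subtrees of a large one has the property that, whenever it is erased in part,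
another run of erased positions lies outside of it. -/
lemma exists_uncritical {a : ℕ → ℕ} (ha : ∀ i, 0 < a i) {l r s₀ s₁ p L e w : ℕ}
    (hp : Occurs a h (L + e + 1 + 1) p) (hlp : l ≤ p) (hpr : p + len a (L + e + 1 + 1) ≤ r)
    (hN : r ≤ N) (hl : P.flow s₀ l = P.flow s₁ l) (hr : P.flow s₀ r = P.flow s₁ r)
    (hempty : ∀ b, p ≤ b → b < p + len a (L + e + 1 + 1) → b ∉ P.erased s₀)
    (hw : ∀ t, runs (P.erased t) 0 N ≤ w) (hW : w * total a L < a (L + e + 1)) :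
    ∃ q, Occurs a h L q ∧ p ≤ q ∧ q + len a L ≤ p + len a (L + e + 1 + 1) ∧
      ∀ s, s₀ ≤ s → s ≤ s₁ → (∃ b, q ≤ b ∧ b < q + len a L ∧ b ∈ P.erased s) →
        (∃ b, q ≤ b ∧ b < q + len a L ∧ b ∉ P.erased s) →
        runs (P.erased s) q (q + len a L) < runs (P.erased s) l r := by
  have hsub : ∀ {p'}, Occurs a h (L + e) p' → ∃ q, Occurs a h L q ∧ p' ≤ q ∧
      q + len a L ≤ p' + len a (L + e) := by
    intro p' hp'
    obtain ⟨Q, hQ, hQ', -⟩ := hp'.descend (len_pos ha L)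
    obtain ⟨q, hq⟩ := Finset.card_pos.1 (hQ ▸ Nat.two_pow_pos e)
    exact ⟨q, hQ' q hq⟩
  -- `A` and `B` are the two halves; the interiors of both rise at least `a (L + e + 1)` above the
  -- valley `z` between them. The four candidates lie in the four quarters.
  have hA := hp.fst
  have hB := hp.snd
  have hz : h (p + a (L + e + 1 + 1)) = h (p + a (L + e + 1 + 1) + len a (L + e + 1)) :=
    hA.height_end.symm
  have hlen := len_succ a (L + e + 1)
  have hlen' := len_succ a (L + e)
  have hApos := @Occurs.height_inner_ge _ _ _ _ hA
  have hBpos := @Occurs.height_inner_ge _ _ _ _ hB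
  obtain ⟨q₁, o₁, i₁, j₁⟩ := hsub hA.fst
  obtain ⟨q₂, o₂, i₂, j₂⟩ := hsub hA.snd
  obtain ⟨q₃, o₃, i₃, j₃⟩ := hsub hB.fst
  obtain ⟨q₄, o₄, i₄, j₄⟩ := hsub hB.snd
  have hflow : ∀ x, P.flow s₀ x = P.flow s₁ x → ∀ s, s₀ ≤ s → s ≤ s₁ →
      P.flow s x = P.flow s₀ x := fun x hx s h1 h2 =>
    le_antisymm (hx ▸ P.flow_mono x h2) (P.flow_mono x h1)
  have hHW : ∀ (s : ℕ) {q : ℕ}, q + len a L ≤ N →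
      ((runs (P.erased s) q (q + len a L) : ℕ) : ℤ) * (total a L : ℕ) < (a (L + e + 1) : ℕ) := by
    intro s q hq
    have h1 := (runs_mono (P.erased s) (Nat.zero_le q) (Nat.le_add_right q (len a L)) hq).trans
      (hw s)
    exact_mod_cast (Nat.mul_le_mul_right (total a L) h1).trans_lt hW
  have hpos := len_pos ha L
  set z := p + a (L + e + 1 + 1) + len a (L + e + 1) with hzdef
  by_contra! hcon
  obtain ⟨s₁', u₁, v₁, ⟨b₁, hb₁⟩, ⟨c₁, hc₁⟩, r₁⟩ := hcon q₁ o₁ (by omega) (by omega)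
  obtain ⟨s₂', u₂, v₂, ⟨b₂, hb₂⟩, ⟨c₂, hc₂⟩, r₂⟩ := hcon q₂ o₂ (by omega) (by omega)
  obtain ⟨s₃', u₃, v₃, ⟨b₃, hb₃⟩, ⟨c₃, hc₃⟩, r₃⟩ := hcon q₃ o₃ (by omega) (by omega)
  obtain ⟨s₄', u₄, v₄, ⟨b₄, hb₄⟩, ⟨c₄, hc₄⟩, r₄⟩ := hcon q₄ o₄ (by omega) (by omega)
  -- If `s₃' ≤ s₄'`, the run through the valley has filled the fourth subtree too early. Otherwise
  -- the third, still unfinished at `s₄'`, separates `b` from the fourth.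
  have fromLeft : ∀ b t, b ∈ P.erased t → l ≤ b → b < z → t ≤ s₃' → t ≤ s₄' → False := by
    intro b t hb h1 h2 h3 h4
    rcases le_total s₃' s₄' with h5 | h5
    · have := P.full_of_valley_left (z := z) (m := q₄ + len a L) (W := (a (L + e + 1) : ℕ))
        u₃ (hflow r hr s₃' u₃ v₃) hN (by omega) (Nat.le_add_right q₃ (len a L)) (by omega)
        (by omega) h1 h2 (P.erased_mono h3 hb) (fun c h6 h7 => hempty c (by omega) (by omega))
        r₃ o₃.height_end (fun x => o₃.le) (fun x => o₃.le_add_total)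
        (fun x h6 h7 => hBpos (by omega) (by omega)) (hHW s₃' (by omega))
      exact hc₄.2.2 (P.erased_mono h5 (this c₄ (by omega) (by omega)))
    · refine r₄.not_gt (runs_lt_of_gap_left (P.erased_mono h4 hb)
        (fun hc => hc₃.2.2 (P.erased_mono h5 hc)) h1 (by omega) (by omega)
        (Nat.le_add_right q₄ (len a L)) (by omega))
  have fromRight : ∀ b t, b ∈ P.erased t → z ≤ b → b < r → t ≤ s₁' → t ≤ s₂' → False := by
    intro b t hb h1 h2 h3 h4
    rcases le_total s₂' s₁' with h5 | h5
    · have := P.full_of_valley_right (z := z) (m := q₁) (W := (a (L + e + 1) : ℕ))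
        u₂ (hflow l hl s₂' u₂ v₂) hN (by omega) (Nat.le_add_right q₂ (len a L)) (by omega)
        (by omega) h1 h2 (P.erased_mono h4 hb) (fun c h6 h7 => hempty c (by omega) (by omega))
        r₂ o₂.height_end (fun x => o₂.le) (fun x => o₂.le_add_total)
        (fun x h6 h7 => hz ▸ hApos (by omega) (by omega)) (hHW s₂' (by omega))
      exact hc₁.2.2 (P.erased_mono h5 (this c₁ (by omega) (by omega)))
    · refine r₁.not_gt (runs_lt_of_gap_right (P.erased_mono h3 hb)
        (fun hc => hc₂.2.2 (P.erased_mono h5 hc)) (by omega)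
        (Nat.le_add_right q₁ (len a L)) (by omega) (by omega) h2)
  -- None of the four moments can be the earliest, since what is erased then stays erased at the two
  -- moments across the valley.
  have f₁ : ¬(s₁' ≤ s₃' ∧ s₁' ≤ s₄') := fun hle =>
    fromLeft b₁ s₁' hb₁.2.2 (by omega) (by omega) hle.1 hle.2
  have f₂ : ¬(s₂' ≤ s₃' ∧ s₂' ≤ s₄') := fun hle =>
    fromLeft b₂ s₂' hb₂.2.2 (by omega) (by omega) hle.1 hle.2
  have f₃ : ¬(s₃' ≤ s₁' ∧ s₃' ≤ s₂') := fun hle =>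
    fromRight b₃ s₃' hb₃.2.2 (by omega) (by omega) hle.1 hle.2
  have f₄ : ¬(s₄' ≤ s₁' ∧ s₄' ≤ s₂') := fun hle =>
    fromRight b₄ s₄' hb₄.2.2 (by omega) (by omega) hle.1 hle.2
  omega

/-- If a subtree of `k * (e + 2 + d) + 1` levels inside `[l, r)` is erased completely while no
pair crosses the ends of `[l, r)`, then at some time `[l, r)` has at least `k` erased runs. -/
lemma exists_runs_ge {a : ℕ → ℕ} (ha : ∀ i, 0 < a i) {w H d e top : ℕ}
    (hH : ∀ t, ∀ x ≤ N, P.flow t x ≤ H)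
    (hw : ∀ t, runs (P.erased t) 0 N ≤ w ∧ (ends (P.erased t)).card ≤ w)
    (hW : ∀ L, L + e + 2 ≤ top → w * total a L < a (L + e + 1))
    (hd : 2 * H * (2 * w + 2) < 2 ^ d) (k : ℕ) :
    ∀ {l r s₀ s₁ p L : ℕ}, k * (e + 2 + d) + 1 ≤ L → L ≤ top → Occurs a h L p → l ≤ p →
      p + len a L ≤ r → r ≤ N → s₀ ≤ s₁ → P.flow s₀ l = P.flow s₁ l →
      P.flow s₀ r = P.flow s₁ r →
      (∀ b, p ≤ b → b < p + len a L → b ∉ P.erased s₀) →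
      (∀ b, p ≤ b → b < p + len a L → b ∈ P.erased s₁) →
      ∃ s, s₀ ≤ s ∧ s ≤ s₁ ∧ k ≤ runs (P.erased s) l r ∧
        (∃ b, l ≤ b ∧ b < r ∧ b ∈ P.erased s) ∧
        ∃ b, p ≤ b ∧ b < p + len a L ∧ b ∉ P.erased s := by
  induction k with
  | zero =>
    intro l r s₀ s₁ p L hL _ hp hlp hpr hN hs _ _ hempty hfull
    obtain ⟨L, rfl⟩ : ∃ L', L = L' + 1 := ⟨L - 1, by omega⟩
    -- A step erases at most two positions, so length three guarantees an unerased one right after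
    -- the first touch. This is why one spare level is required.
    have hlen : 3 ≤ len a (L + 1) := by
      have h1 := len_succ a L
      have h2 := len_pos ha L
      have h3 := ha (L + 1)
      omega
    have hne : ∃ t, ∃ b, p ≤ b ∧ b < p + len a (L + 1) ∧ b ∈ P.erased t :=
      ⟨s₁, p, le_rfl, by omega, hfull p le_rfl (by omega)⟩
    classical
    obtain ⟨b₀, hb1, hb2, hb3⟩ := Nat.find_spec hne
    have hlt : s₀ < Nat.find hne := by
      by_contra! hle
      exact hempty b₀ hb1 hb2 (P.erased_mono hle hb3)
    refine ⟨Nat.find hne, hlt.le,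
      Nat.find_min' hne ⟨p, le_rfl, by omega, hfull p le_rfl (by omega)⟩, Nat.zero_le _,
      ⟨b₀, by omega, by omega, hb3⟩, ?_⟩
    by_contra! hcon
    have hsub : Finset.Ico p (p + len a (L + 1)) ⊆
        P.erased (Nat.find hne - 1 + 1) \ P.erased (Nat.find hne - 1) := by
      intro b hb
      rw [Finset.mem_Ico] at hb
      rw [Finset.mem_sdiff, Nat.sub_add_cancel (by omega)]
      exact ⟨hcon b hb.1 hb.2, fun hb' =>
        Nat.find_min hne (m := Nat.find hne - 1) (by omega) ⟨b, hb.1, hb.2, hb'⟩⟩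
    have h1 := Finset.card_le_card hsub
    have h2 := P.card_step (Nat.find hne - 1)
    rw [Nat.card_Ico] at h1
    omega
  | succ k ih =>
    intro l r s₀ s₁ p L hL htop hp hlp hpr hN hs hl hr hempty hfull
    -- The round spends `e + 2` levels on reaching an uncritical subtree and `d` levels on finding a
    -- quiet one inside it. The uncritical subtree is the next window.
    obtain ⟨L', rfl⟩ : ∃ L', L = L' + d + e + 1 + 1 := ⟨L - (e + 2 + d), by
      rw [Nat.succ_mul] at hL
      omega⟩
    have hL' : k * (e + 2 + d) + 1 ≤ L' := by
      rw [Nat.succ_mul] at hL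
      omega
    obtain ⟨q, oq, hpq, hqp, hun⟩ := P.exists_uncritical ha hp hlp hpr hN hl hr hempty
      (fun t => (hw t).1) (hW _ (by omega))
    obtain ⟨Q, hQc, hQ, hQd⟩ := oq.descend (len_pos ha L')
    obtain ⟨q', hq', u, v, hu, huv, hv, hue, hvf, hfl, hfr⟩ :=
      P.exists_quiet_interval (l := q) (r := q + len a (L' + d)) (len_pos ha L') hs hQd
      (fun q' hq' => by have := hQ q' hq'; omega)
      (fun q' hq' b h1 h2 => by have := hQ q' hq'; exact hempty b (by omega) (by omega))
      (fun q' hq' b h1 h2 => by have := hQ q' hq'; exact hfull b (by omega) (by omega))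
      (fun t => ⟨hH t _ (by omega), hH t _ (by omega)⟩) hw (hQc ▸ hd)
    obtain ⟨o', h1, h2⟩ := hQ q' hq'
    obtain ⟨s, hs1, hs2, hk, ⟨b, hb1, hb2, hb3⟩, c, hc1, hc2, hc3⟩ :=
      ih hL' (by omega) o' h1 h2 (by omega) huv hfl hfr hue hvf
    refine ⟨s, by omega, by omega, ?_, ⟨b, by omega, by omega, hb3⟩, c, by omega, by omega, hc3⟩
    have := hun s (by omega) (by omega) ⟨b, hb1, hb2, hb3⟩ ⟨c, by omega, by omega, hc3⟩
    omega

end Play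

/-! ### Runs and the width of a set -/

/-- Singletons suffice. Thus the infimum in `setWidth` is attained and is not the default value `0`
of an empty infimum. -/
lemma exists_intervals (E : Finset ℕ) : ∃ k : ℕ, ∃ I : Fin k → ℤ × ℤ,
    {b : ℤ | ∃ n ∈ E, b = (n : ℤ)} = ⋃ i, Set.Icc (I i).1 (I i).2 := by
  refine ⟨E.card, fun i => (((E.equivFin.symm i : ℕ) : ℤ), ((E.equivFin.symm i : ℕ) : ℤ)), ?_⟩
  ext b
  simp only [Set.mem_ofPred_eq, Set.Icc_self, Set.mem_iUnion, Set.mem_singleton_iff]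
  constructor
  · rintro ⟨n, hn, rfl⟩
    exact ⟨E.equivFin ⟨n, hn⟩, by simp⟩
  · rintro ⟨i, rfl⟩
    exact ⟨_, (E.equivFin.symm i).2, rfl⟩

/-- The start of a run is the left endpoint of any interval containing it, since otherwise its
predecessor would belong to `E`; likewise for ends and right endpoints. The intervals may overlap.
-/
lemma runs_le_of_eq_iUnion {E : Finset ℕ} {k : ℕ} {I : Fin k → ℤ × ℤ}
    (hI : {b : ℤ | ∃ n ∈ E, b = (n : ℤ)} = ⋃ i, Set.Icc (I i).1 (I i).2) (N : ℕ) :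
    runs E 0 N ≤ k ∧ (ends E).card ≤ k := by
  have hmem : ∀ n ∈ E, ∃ i, (I i).1 ≤ n ∧ (n : ℤ) ≤ (I i).2 := by
    intro n hn
    have : (n : ℤ) ∈ {b : ℤ | ∃ n ∈ E, b = (n : ℤ)} := ⟨n, hn, rfl⟩
    rw [hI] at this
    simpa using this
  have hmem' : ∀ (i : Fin k) (b : ℤ), (I i).1 ≤ b → b ≤ (I i).2 → ∃ n ∈ E, b = (n : ℤ) := by
    intro i b h1 h2
    have : b ∈ ⋃ i, Set.Icc (I i).1 (I i).2 := Set.mem_iUnion.2 ⟨i, h1, h2⟩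
    rwa [← hI] at this
  have hcard : ∀ (s : Finset ℕ) (f : Fin k → ℕ), s ⊆ Finset.univ.image f → s.card ≤ k :=
    fun s f hs => (Finset.card_le_card hs).trans (Finset.card_image_le.trans (by simp))
  constructor
  · refine hcard _ (fun i => (I i).1.toNat) fun b hb => ?_
    obtain ⟨-, hbE, hb⟩ := mem_starts.1 hb
    obtain ⟨i, h1, h2⟩ := hmem b hbE
    refine Finset.mem_image.2 ⟨i, Finset.mem_univ i, ?_⟩
    have : (I i).1 = b := by
      by_contra hne
      obtain ⟨n, hn, hbn⟩ := hmem' i (b - 1) (by omega) (by omega)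
      rcases hb with rfl | hb
      · omega
      · exact hb (by rwa [show b - 1 = n by omega])
    omega
  · refine hcard _ (fun i => (I i).2.toNat) fun b hb => ?_
    obtain ⟨hbE, hb⟩ := Finset.mem_filter.1 hb
    obtain ⟨i, h1, h2⟩ := hmem b hbE
    refine Finset.mem_image.2 ⟨i, Finset.mem_univ i, ?_⟩
    have : (I i).2 = b := by
      by_contra hne
      obtain ⟨n, hn, hbn⟩ := hmem' i (b + 1) (by omega) (by omega)
      exact hb (by rwa [show b + 1 = n by omega])
    omega

lemma runs_le_setWidth (E : Finset ℕ) (N : ℕ) :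
    runs E 0 N ≤ setWidth {b : ℤ | ∃ n ∈ E, b = (n : ℤ)} ∧
      (ends E).card ≤ setWidth {b : ℤ | ∃ n ∈ E, b = (n : ℤ)} := by
  obtain ⟨I, hI⟩ := Nat.sInf_mem (exists_intervals E)
  exact runs_le_of_eq_iUnion hI N

/-! ### The play of a re-pairing -/

namespace RePairing

variable {σ : DyckWord} (p : RePairing σ)

/-- The positions erased by the first `t` pairs, as a finite set of natural numbers. -/
def erasedNat (t : ℕ) : Finset ℕ :=
  (Finset.univ.filter fun i : Fin (σ.toList.length / 2) => (i : ℕ) < t).biUnion fun i =>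
    {(p.left i : ℕ), (p.right i : ℕ)}

lemma mem_erasedNat {t b : ℕ} : b ∈ p.erasedNat t ↔
    ∃ i : Fin (σ.toList.length / 2), (i : ℕ) < t ∧ (b = p.left i ∨ b = p.right i) := by
  simp [erasedNat]

lemma erased_eq (t : ℕ) : p.erased t = {b : ℤ | ∃ n ∈ p.erasedNat t, b = (n : ℤ)} := by
  ext b
  simp only [erased, Set.mem_ofPred_eq, mem_erasedNat]
  constructor
  · rintro ⟨i, hi, h | h⟩
    · exact ⟨_, ⟨i, hi, Or.inl rfl⟩, h⟩
    · exact ⟨_, ⟨i, hi, Or.inr rfl⟩, h⟩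
  · rintro ⟨n, ⟨i, hi, h | h⟩, rfl⟩
    · exact ⟨i, hi, Or.inl (by rw [h])⟩
    · exact ⟨i, hi, Or.inr (by rw [h])⟩

lemma erasedNat_mono : Monotone p.erasedNat := fun s t hst b hb => by
  rw [mem_erasedNat] at hb ⊢
  obtain ⟨i, hi, h⟩ := hb
  exact ⟨i, by omega, h⟩

lemma setWidth_erased_le_width (t : ℕ) : setWidth (p.erased t) ≤ p.width := by
  rcases le_total t (σ.toList.length / 2) with ht | ht
  · exact Finset.le_sup (f := fun t => setWidth (p.erased t))
      (Finset.mem_range.2 (Nat.lt_succ_of_le ht))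
  · have : p.erased t = p.erased (σ.toList.length / 2) := by
      ext b
      constructor
      · rintro ⟨i, -, h⟩
        exact ⟨i, i.2, h⟩
      · rintro ⟨i, hi, h⟩
        exact ⟨i, by omega, h⟩
    rw [this]
    exact Finset.le_sup (f := fun t => setWidth (p.erased t))
      (Finset.mem_range.2 (Nat.lt_succ_self _))

/-- The number of the first `t` pairs that cross the cut in front of the position `x`. -/
def flow (t x : ℕ) : ℤ :=
  ∑ i : Fin (σ.toList.length / 2) with i.1 < t,
    if (p.left i : ℕ) < x ∧ x ≤ p.right i then 1 else 0

/-- Moving the cut past `x` affects only the pair containing `x`: it begins to cross if `x` is an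
opening bracket and ceases to cross if `x` is a closing one, matching the height step. -/
lemma flow_succ (t x : ℕ) (hx : x < σ.toList.length) : p.flow t (x + 1) =
    p.flow t x + if x ∈ p.erasedNat t then height σ.toList (x + 1) - height σ.toList x else 0 := by
  have hstep : ∀ i, ((if (p.left i : ℕ) < x + 1 ∧ x + 1 ≤ p.right i then 1 else 0 : ℤ)) =
      (if (p.left i : ℕ) < x ∧ x ≤ p.right i then 1 else 0) +
        if x = p.left i ∨ x = p.right i then
          height σ.toList (x + 1) - height σ.toList x else 0 := by
    intro i
    have hlt : (p.left i : ℕ) < p.right i := p.left_lt_right i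
    by_cases h1 : x = p.left i
    · have := height_succ σ.toList (p.left i)
      rw [if_pos (p.left_open i), ← h1] at this
      rw [if_pos (by omega), if_neg (by omega), if_pos (Or.inl h1)]
      linarith
    by_cases h2 : x = p.right i
    · have := height_succ σ.toList (p.right i)
      rw [if_neg (by rw [p.right_close i]; decide), ← h2] at this
      rw [if_neg (by omega), if_pos (by omega), if_pos (Or.inr h2)]
      linarith
    rw [if_neg (c := x = _ ∨ _) (by omega), add_zero]
    congr 1
    simp only [eq_iff_iff]
    omega
  simp only [flow, hstep, Finset.sum_add_distrib]
  congr 1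
  obtain ⟨i₀, hi₀, huniq⟩ := p.exactly_one ⟨x, hx⟩
  have hi₀' : x = p.left i₀ ∨ x = p.right i₀ := by simpa [Fin.ext_iff] using hi₀
  have huniq' : ∀ i, (x = p.left i ∨ x = p.right i) → i = i₀ := fun i hi =>
    huniq i (by simpa [Fin.ext_iff] using hi)
  by_cases ht : (i₀ : ℕ) < t
  · rw [if_pos (p.mem_erasedNat.2 ⟨i₀, ht, hi₀'⟩), Finset.sum_eq_single i₀, if_pos hi₀']
    · intro i _ hne
      exact if_neg fun hi => hne (huniq' i hi)
    · simp [ht]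
  · rw [if_neg, Finset.sum_eq_zero]
    · intro i hi
      refine if_neg fun h => ht ?_
      rw [← huniq' i h]
      exact (Finset.mem_filter.1 hi).2
    · rw [mem_erasedNat]
      rintro ⟨i, hi, h⟩
      exact ht (huniq' i h ▸ hi)

/-- The course of a re-pairing. -/
def toPlay : Play (height σ.toList) σ.toList.length where
  erased := p.erasedNat
  flow := p.flow
  erased_mono := p.erasedNat_mono
  flow_mono x s t hst := Finset.sum_le_sum_of_subset_of_nonneg
    (fun i hi => by
      rw [Finset.mem_filter] at hi ⊢
      exact ⟨hi.1, by omega⟩)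
    fun i _ _ => by split_ifs <;> simp
  flow_nonneg t x := Finset.sum_nonneg fun i _ => by split_ifs <;> simp
  flow_succ := p.flow_succ
  card_step t := by
    by_cases ht : t < σ.toList.length / 2
    · refine le_trans (Finset.card_le_card (t := {(p.left ⟨t, ht⟩ : ℕ), (p.right ⟨t, ht⟩ : ℕ)})
        fun b hb => ?_) (Finset.card_le_two)
      rw [Finset.mem_sdiff, mem_erasedNat, mem_erasedNat] at hb
      obtain ⟨⟨i, hi, h⟩, hn⟩ := hb
      have : i = ⟨t, ht⟩ := by
        ext
        by_contra hne
        exact hn ⟨i, by simp only at hne; omega, h⟩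
      subst this
      simpa using h
    · rw [Finset.sdiff_eq_empty_iff_subset.2, Finset.card_empty]
      · omega
      · intro b hb
        rw [mem_erasedNat] at hb ⊢
        obtain ⟨i, -, h⟩ := hb
        exact ⟨i, by omega, h⟩

lemma mem_erasedNat_end {b : ℕ} (hb : b < σ.toList.length) :
    b ∈ p.erasedNat (σ.toList.length / 2) := by
  obtain ⟨i, hi, -⟩ := p.exactly_one ⟨b, hb⟩
  exact p.mem_erasedNat.2 ⟨i, i.2, by simpa [Fin.ext_iff] using hi⟩

lemma flow_left_end (t : ℕ) : p.flow t 0 = 0 := by simp [flow]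

lemma flow_right_end (t : ℕ) : p.flow t σ.toList.length = 0 := by
  refine Finset.sum_eq_zero fun i _ => if_neg ?_
  have := (p.right i).2
  omega

/-- Once everything is erased, the flow from the left end reproduces the height; earlier it is a sum
over fewer pairs. -/
lemma flow_le_height (t : ℕ) {x : ℕ} (hx : x ≤ σ.toList.length) :
    p.flow t x ≤ height σ.toList x := by
  have hend : p.flow (σ.toList.length / 2) x = height σ.toList x := by
    have := p.toPlay.flow_eq_of_full (t := σ.toList.length / 2) (Nat.zero_le x) hx
      fun b _ hb => p.mem_erasedNat_end (by omega)
    simpa [toPlay, flow_left_end] using this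
  rw [← hend]
  exact Finset.sum_le_sum_of_subset_of_nonneg (fun i hi => by simp)
    fun i _ _ => by split_ifs <;> simp

end RePairing

/-! ### Existence of a re-pairing -/

lemma count_eq_count_take (l : List DyckStep) (c : DyckStep) {x : ℕ} (hx : x ≤ l.length) :
    Nat.count (fun i => l[i]? = some c) x = (l.take x).count c := by
  induction x with
  | zero => simp
  | succ x ih =>
    have h : l.take (x + 1) = l.take x ++ [l[x]] := by simp
    rw [Nat.count_succ, ih (by omega), h, List.count_append, List.getElem?_eq_getElem (by omega),
      List.count_singleton]
    simp only [Option.some_inj, beq_iff_eq]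

lemma nth_mem_of_lt_count {p : ℕ → Prop} [DecidablePred p] {i n : ℕ} (h : i < Nat.count p n) :
    p (Nat.nth p i) :=
  Nat.nth_mem i fun hf => h.trans_le (Nat.count_le_card hf n)

lemma count_nth_of_lt_count {p : ℕ → Prop} [DecidablePred p] {i n : ℕ}
    (h : i < Nat.count p n) : Nat.count p (Nat.nth p i) = i :=
  Nat.count_nth fun hf => h.trans_le (Nat.count_le_card hf n)

/-- Every Dyck word has a re-pairing: pair the `i`-th opening with the `i`-th closing bracket. -/
lemma nonempty_rePairing (σ : DyckWord) : Nonempty (RePairing σ) := by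
  have hsum : ∀ m : List DyckStep, m.count DyckStep.U + m.count DyckStep.D = m.length := by
    intro m
    induction m with
    | nil => rfl
    | cons c m ih => cases c <;> simp <;> omega
  have hU : Nat.count (fun i => σ.toList[i]? = some DyckStep.U) σ.toList.length =
      σ.toList.length / 2 := by
    rw [count_eq_count_take σ.toList _ le_rfl, List.take_length]
    have := hsum σ.toList
    have := σ.count_U_eq_count_D
    omega
  have hD : Nat.count (fun i => σ.toList[i]? = some DyckStep.D) σ.toList.length =
      σ.toList.length / 2 := by
    rw [count_eq_count_take σ.toList _ le_rfl, List.take_length]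
    have := hsum σ.toList
    have := σ.count_U_eq_count_D
    omega
  have hiU : ∀ i : Fin (σ.toList.length / 2),
      (i : ℕ) < Nat.count (fun i => σ.toList[i]? = some DyckStep.U) σ.toList.length := fun i => by
    rw [hU]; exact i.2
  have hiD : ∀ i : Fin (σ.toList.length / 2),
      (i : ℕ) < Nat.count (fun i => σ.toList[i]? = some DyckStep.D) σ.toList.length := fun i => by
    rw [hD]; exact i.2
  have hmU := fun i => nth_mem_of_lt_count (hiU i)
  have hmD := fun i => nth_mem_of_lt_count (hiD i)
  have hcU := fun i => count_nth_of_lt_count (hiU i)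
  have hcD := fun i => count_nth_of_lt_count (hiD i)
  have hlU := fun i => Nat.nth_lt_of_lt_count (hiU i)
  have hlD := fun i => Nat.nth_lt_of_lt_count (hiD i)
  refine ⟨⟨fun i => ⟨_, hlU i⟩, fun i => ⟨_, hlD i⟩, fun i => ?_, fun i => ?_, fun i => ?_,
    fun b => ?_⟩⟩
  · have := hmU i
    rw [List.getElem?_eq_getElem (hlU i), Option.some_inj] at this
    exact this
  · have := hmD i
    rw [List.getElem?_eq_getElem (hlD i), Option.some_inj] at this
    exact this
  -- The prefix through the `i`-th closing bracket has `i + 1` closing brackets, counting from `0`,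
  -- hence at least as many opening ones, so it contains the `i`-th opening bracket.
  · have h1 : (i : ℕ) < Nat.count (fun i => σ.toList[i]? = some DyckStep.D)
        (Nat.nth (fun i => σ.toList[i]? = some DyckStep.D) i + 1) := by
      rw [Nat.count_succ, hcD i, if_pos (hmD i)]
      omega
    rw [count_eq_count_take σ.toList _ (hlD i)] at h1
    have h2 := h1.trans_le (σ.count_D_le_count_U _)
    rw [← count_eq_count_take σ.toList _ (hlD i)] at h2
    refine lt_of_le_of_ne (Nat.lt_succ_iff.1 (Nat.nth_lt_of_lt_count h2)) fun he => ?_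
    have h3 := hmU i
    rw [Fin.mk.injEq] at he
    rw [he, hmD i] at h3
    exact absurd h3 (by decide)
  · have hb : σ.toList[(b : ℕ)]? = some (σ.toList.get b) := by simp
    rcases (σ.toList.get b).dichotomy with hc | hc <;> rw [hc] at hb
    · have hlt := Nat.count_strict_mono (p := fun i => σ.toList[i]? = some DyckStep.U) hb b.2
      rw [hU] at hlt
      refine ⟨⟨_, hlt⟩, Or.inl (Fin.ext (Nat.nth_count hb).symm), fun j hj => Fin.ext ?_⟩
      rcases hj with hj | hj
      · rw [Fin.ext_iff] at hj
        simp only at hj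
        simp only [hj, hcU j]
      · have := hmD j
        rw [Fin.ext_iff] at hj
        simp only at hj
        rw [← hj, hb] at this
        exact absurd this (by decide)
    · have hlt := Nat.count_strict_mono (p := fun i => σ.toList[i]? = some DyckStep.D) hb b.2
      rw [hD] at hlt
      refine ⟨⟨_, hlt⟩, Or.inr (Fin.ext (Nat.nth_count hb).symm), fun j hj => Fin.ext ?_⟩
      rcases hj with hj | hj
      · have := hmU j
        rw [Fin.ext_iff] at hj
        simp only at hj
        rw [← hj, hb] at this
        exact absurd this (by decide)
      · rw [Fin.ext_iff] at hj
        simp only at hj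
        simp only [hj, hcD j]

/-! ### Lower bounds on the width -/

/-- A lower bound on the width of `X(a₀, …, a_L)`. -/
theorem le_width_X {a : ℕ → ℕ} (ha : ∀ i, 0 < a i) {w d e L k : ℕ}
    (hwidth : width (X a L) ≤ w)
    (hW : ∀ M, M + e + 2 ≤ L → w * total a M < a (M + e + 1))
    (hd : 2 * total a L * (2 * w + 2) < 2 ^ d) (hk : k * (e + 2 + d) + 1 ≤ L) :
    k ≤ width (X a L) := by
  have := nonempty_rePairing (X a L)
  obtain ⟨p, hp⟩ := Nat.sInf_mem (Set.range_nonempty fun p : RePairing (X a L) => p.width)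
  have hp : p.width = width (X a L) := hp
  have hruns : ∀ t, runs (p.erasedNat t) 0 (len a L) ≤ p.width ∧
      (ends (p.erasedNat t)).card ≤ p.width := by
    intro t
    have h1 := p.setWidth_erased_le_width t
    rw [p.erased_eq] at h1
    have h2 := runs_le_setWidth (p.erasedNat t) (len a L)
    exact ⟨h2.1.trans h1, h2.2.trans h1⟩
  -- The first window is the whole word, whose end cuts are never crossed.
  obtain ⟨s, -, -, hs, -⟩ := p.toPlay.exists_runs_ge ha (w := w) (H := total a L) (d := d)
    (e := e) (top := L)
    (fun t x hx => (p.flow_le_height t hx).trans (height_X_le a L hx))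
    (fun t => ⟨(hruns t).1.trans (hp ▸ hwidth), (hruns t).2.trans (hp ▸ hwidth)⟩) hW hd k
    (l := 0) (r := len a L) (s₀ := 0) (s₁ := len a L / 2) (p := 0) hk le_rfl
    (fun i _ => by simp) le_rfl (by simp) le_rfl (Nat.zero_le _)
    ((p.flow_left_end _).trans (p.flow_left_end _).symm)
    ((p.flow_right_end _).trans (p.flow_right_end _).symm)
    (fun b _ _ hb => by
      obtain ⟨i, hi, -⟩ := p.mem_erasedNat.1 hb
      omega)
    (fun b _ hb => p.mem_erasedNat_end (by rwa [zero_add] at hb))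
  exact hs.trans ((hruns s).1.trans hp.le)

/-- A geometric series of `q` blocks of `ℓ` equal terms; adding `ℓ` avoids subtraction. -/
lemma sum_two_pow_div {ℓ : ℕ} (hℓ : 0 < ℓ) (q : ℕ) :
    ∑ i ∈ Finset.range (ℓ * q), 2 ^ (i / ℓ) + ℓ = ℓ * 2 ^ q := by
  induction q with
  | zero => simp
  | succ q ih =>
    have hblock : ∑ i ∈ Finset.range ℓ, 2 ^ ((ℓ * q + i) / ℓ) = ℓ * 2 ^ q := by
      rw [Finset.sum_congr rfl (g := fun _ => 2 ^ q), Finset.sum_const, Finset.card_range,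
        smul_eq_mul]
      intro i hi
      rw [Nat.mul_add_div hℓ, Nat.div_eq_of_lt (Finset.mem_range.1 hi), add_zero]
    rw [Nat.mul_succ, Finset.sum_range_add, hblock, pow_succ]
    linarith

lemma total_two_pow_div_le {ℓ : ℕ} (hℓ : 0 < ℓ) (L : ℕ) :
    total (fun i => 2 ^ (i / ℓ)) L ≤ ℓ * 2 ^ (L / ℓ + 1) := by
  rw [← sum_two_pow_div hℓ]
  refine le_trans (Finset.sum_le_sum_of_subset fun i hi => ?_) (Nat.le_add_right _ _)
  rw [Finset.mem_range] at hi ⊢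
  exact Nat.lt_of_lt_of_le hi (Nat.lt_mul_div_succ L hℓ)

lemma two_pow_le_len {a : ℕ → ℕ} (ha : ∀ i, 0 < a i) (L : ℕ) : 2 ^ (L + 1) ≤ len a L := by
  induction L with
  | zero => rw [len_zero]; have := ha 0; omega
  | succ L ih => rw [len_succ, pow_succ]; omega

lemma len_le (a : ℕ → ℕ) (L : ℕ) : len a L ≤ 2 ^ (L + 1) * total a L := by
  induction L with
  | zero => rw [len_zero]; simp [total]; omega
  | succ L ih =>
    rw [len_succ, total_succ, pow_succ, mul_add]
    have : 1 ≤ 2 ^ (L + 1) := Nat.one_le_two_pow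
    nlinarith

lemma floor_mul_logb_bounds {ℓ : ℕ} (hℓ : 2 ≤ ℓ) :
    ℓ * Nat.log 2 ℓ ≤ ⌊(ℓ : ℝ) * Real.logb 2 ℓ⌋₊ ∧
      ⌊(ℓ : ℝ) * Real.logb 2 ℓ⌋₊ ≤ ℓ * (Nat.log 2 ℓ + 1) := by
  have hpos : (0 : ℝ) < ℓ := by positivity
  have h1 : ((Nat.log 2 ℓ : ℕ) : ℝ) ≤ Real.logb 2 ℓ := by
    rw [Real.le_logb_iff_rpow_le (by norm_num) hpos, Real.rpow_natCast]
    exact_mod_cast Nat.pow_log_le_self 2 (by omega)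
  have h2 : Real.logb 2 ℓ ≤ ((Nat.log 2 ℓ + 1 : ℕ) : ℝ) := by
    rw [Real.logb_le_iff_le_rpow (by norm_num) hpos, Real.rpow_natCast]
    exact_mod_cast (Nat.lt_pow_succ_log_self (by norm_num) ℓ).le
  constructor
  · refine Nat.le_floor ?_
    push_cast
    exact mul_le_mul_of_nonneg_left h1 hpos.le
  · refine Nat.floor_le_of_le ?_
    rw [Nat.cast_mul]
    exact mul_le_mul_of_nonneg_left h2 hpos.le

/-- The width of `Y(ℓ)` grows at least linearly. -/
theorem div_le_width_Y {ℓ : ℕ} (hℓ : 6 ≤ ℓ) : ℓ / 10 ≤ width (Y ℓ) := by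
  -- A width of at least `ℓ` already suffices, so the a priori bound `w = ℓ` is free.
  rcases le_total ℓ (width (Y ℓ)) with hw | hw
  · omega
  obtain ⟨hm1, hm2⟩ := floor_mul_logb_bounds (show 2 ≤ ℓ by omega)
  have hg : 1 ≤ Nat.log 2 ℓ := Nat.log_pos (by norm_num) (by omega)
  have hlt : ℓ < 2 ^ (Nat.log 2 ℓ + 1) := Nat.lt_pow_succ_log_self (by norm_num) ℓ
  simp only [Y, Y₂] at hw ⊢
  generalize ⌊(ℓ : ℝ) * Real.logb 2 ℓ⌋₊ = m at *
  generalize Nat.log 2 ℓ = g at *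
  have hsq : ℓ * ℓ < 2 ^ (2 * g + 2) := by
    have := Nat.mul_lt_mul'' hlt hlt
    rwa [← pow_add, show g + 1 + (g + 1) = 2 * g + 2 by ring] at this
  have hm : 1 ≤ m := le_trans (by nlinarith) hm1
  have hmℓ : 1 ≤ m * ℓ := by nlinarith
  have he : 1 ≤ ℓ * (2 * g + 3) := by nlinarith
  -- With `g = ⌊log₂ ℓ⌋`, going up `e + 1` levels multiplies the weight by `2 ^ (2 * g + 3) > 2 * ℓ
  -- ^ 2`, which beats `ℓ` times the height of a small subtree. The value of `d` comes from `2 * (ℓ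
  -- * 2 ^ m) * (4 * ℓ) < 2 ^ (m + 2 * g + 5)`.
  refine le_width_X (fun i => by positivity) hw (e := ℓ * (2 * g + 3) - 1)
    (d := m + 2 * g + 5) ?_ ?_ ?_
  · intro M _
    have h1 : (M + (ℓ * (2 * g + 3) - 1) + 1) / ℓ = M / ℓ + (2 * g + 3) := by
      rw [add_assoc, Nat.sub_add_cancel he, Nat.add_mul_div_left _ _ (by omega)]
    calc ℓ * total (fun i => 2 ^ (i / ℓ)) M ≤ ℓ * (ℓ * 2 ^ (M / ℓ + 1)) :=
          Nat.mul_le_mul_left _ (total_two_pow_div_le (by omega) M)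
      _ = ℓ * ℓ * 2 ^ (M / ℓ + 1) := by ring
      _ < 2 ^ (2 * g + 2) * 2 ^ (M / ℓ + 1) := Nat.mul_lt_mul_of_pos_right hsq (by positivity)
      _ = 2 ^ ((M + (ℓ * (2 * g + 3) - 1) + 1) / ℓ) := by rw [h1, ← pow_add]; ring_nf
  · have h1 : (m * ℓ - 1) / ℓ + 1 = m := by
      have : m * ℓ - 1 = ℓ * (m - 1) + (ℓ - 1) := by
        obtain ⟨m, rfl⟩ := Nat.exists_eq_add_of_le' hm
        rw [Nat.add_sub_cancel, Nat.add_mul, one_mul, mul_comm m]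
        omega
      rw [this, Nat.mul_add_div (by omega), Nat.div_eq_of_lt (by omega)]
      omega
    have h2 := total_two_pow_div_le (show 0 < ℓ by omega) (m * ℓ - 1)
    rw [h1] at h2
    calc 2 * total (fun i => 2 ^ (i / ℓ)) (m * ℓ - 1) * (2 * ℓ + 2)
        ≤ 2 * (ℓ * 2 ^ m) * (4 * ℓ) := Nat.mul_le_mul (Nat.mul_le_mul_left _ h2) (by omega)
      _ = ℓ * ℓ * (2 ^ m * 8) := by ring
      _ < 2 ^ (2 * g + 2) * (2 ^ m * 8) := Nat.mul_lt_mul_of_pos_right hsq (by positivity)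
      _ = 2 ^ (m + 2 * g + 5) := by ring
  -- A round costs at most `9 * ℓ * g` levels, and at least `ℓ ^ 2 * g` are available; the factor
  -- `10` leaves slack for the two units lost to rounding.
  · have hK : ℓ * (2 * g + 3) - 1 + 2 + (m + 2 * g + 5) ≤ 9 * (ℓ * g) := by
      have h1 : ℓ ≤ ℓ * g := Nat.le_mul_of_pos_right ℓ hg
      have h2 : 6 * g ≤ ℓ * g := Nat.mul_le_mul_right g hℓ
      have h3 : ℓ * (2 * g + 3) = 2 * (ℓ * g) + 3 * ℓ := by ring
      have h4 : ℓ * (g + 1) = ℓ * g + ℓ := by ring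
      omega
    have h1 := Nat.mul_le_mul (Nat.mul_div_le ℓ 10) hK
    have h2 : ℓ * g * ℓ ≤ m * ℓ := Nat.mul_le_mul_right ℓ hm1
    have h3 : 6 * 6 ≤ ℓ * g * ℓ := Nat.mul_le_mul (by nlinarith) hℓ
    have h4 : ℓ * (9 * (ℓ * g)) = 9 * (ℓ * g * ℓ) := by ring
    rw [mul_assoc, h4] at h1
    omega

/-- Both bounds of the equivalence `√(log |Y(ℓ)| / log log |Y(ℓ)|) = Θ(ℓ)`. -/
theorem sqrtLogRatio_Y_bounds {ℓ : ℕ} (hℓ : 2 ≤ ℓ) :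
    (ℓ : ℝ) / 3 ≤ sqrtLogRatio (Y ℓ) ∧ sqrtLogRatio (Y ℓ) ≤ 3 * ℓ := by
  obtain ⟨hm1, hm2⟩ := floor_mul_logb_bounds hℓ
  have hg : 1 ≤ Nat.log 2 ℓ := Nat.log_pos (by norm_num) (by omega)
  have hge : 2 ^ Nat.log 2 ℓ ≤ ℓ := Nat.pow_log_le_self 2 (by omega)
  have hlt : ℓ < 2 ^ (Nat.log 2 ℓ + 1) := Nat.lt_pow_succ_log_self (by norm_num) ℓ
  have hN1 := two_pow_le_len (a := fun i => 2 ^ (i / ℓ)) (fun i => by positivity)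
    (⌊(ℓ : ℝ) * Real.logb 2 ℓ⌋₊ * ℓ - 1)
  have hN2 := len_le (fun i => 2 ^ (i / ℓ)) (⌊(ℓ : ℝ) * Real.logb 2 ℓ⌋₊ * ℓ - 1)
  have hT := total_two_pow_div_le (show 0 < ℓ by omega) (⌊(ℓ : ℝ) * Real.logb 2 ℓ⌋₊ * ℓ - 1)
  have hdef : sqrtLogRatio (Y ℓ) = Real.sqrt
      (Real.logb 2 (len (fun i => 2 ^ (i / ℓ)) (⌊(ℓ : ℝ) * Real.logb 2 ℓ⌋₊ * ℓ - 1) : ℕ) /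
        Real.logb 2 (Real.logb 2
          (len (fun i => 2 ^ (i / ℓ)) (⌊(ℓ : ℝ) * Real.logb 2 ℓ⌋₊ * ℓ - 1) : ℕ))) := rfl
  rw [hdef]
  generalize ⌊(ℓ : ℝ) * Real.logb 2 ℓ⌋₊ = m at *
  generalize Nat.log 2 ℓ = g at *
  have hm : 1 ≤ m := le_trans (by nlinarith) hm1
  have hmℓ : 1 ≤ m * ℓ := by nlinarith
  have hdiv : (m * ℓ - 1) / ℓ + 1 ≤ m := by
    have : (m * ℓ - 1) / ℓ < m := by
      rw [Nat.div_lt_iff_lt_mul (by omega)]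
      omega
    omega
  rw [Nat.sub_add_cancel hmℓ] at hN1 hN2
  generalize len (fun i => 2 ^ (i / ℓ)) (m * ℓ - 1) = n at *
  -- With `2 ^ (m * ℓ) ≤ n`, this puts `log n` between `ℓ ^ 2 * g` and `6 * ℓ ^ 2 * g`, and `log log
  -- n` between `g` and `8 * g`. The factor `3` in the theorem works because `8 / 9 ≤ 1` and `6 ≤
  -- 9`.
  have hn : n ≤ 2 ^ (3 * (m * ℓ)) := by
    calc n ≤ 2 ^ (m * ℓ) * (ℓ * 2 ^ ((m * ℓ - 1) / ℓ + 1)) :=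
          hN2.trans (Nat.mul_le_mul_left _ hT)
      _ ≤ 2 ^ (m * ℓ) * (2 ^ (g + 1) * 2 ^ m) := Nat.mul_le_mul_left _
          (Nat.mul_le_mul hlt.le (Nat.pow_le_pow_right (by norm_num) hdiv))
      _ = 2 ^ (m * ℓ + (g + 1 + m)) := by ring
      _ ≤ 2 ^ (3 * (m * ℓ)) := Nat.pow_le_pow_right (by norm_num) (by nlinarith)
  have hnpos : (0 : ℝ) < n := by exact_mod_cast (Nat.two_pow_pos _).trans_le hN1
  have hgR : (1 : ℝ) ≤ g := by exact_mod_cast hg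
  have hℓR : (2 : ℝ) ≤ ℓ := by exact_mod_cast hℓ
  have hA1 : (ℓ : ℝ) ^ 2 * g ≤ Real.logb 2 n := by
    have h1 : ((m * ℓ : ℕ) : ℝ) ≤ Real.logb 2 n := by
      rw [Real.le_logb_iff_rpow_le (by norm_num) hnpos, Real.rpow_natCast]
      exact_mod_cast hN1
    have h2 : ((ℓ ^ 2 * g : ℕ) : ℝ) ≤ (m * ℓ : ℕ) := by
      exact_mod_cast (show ℓ ^ 2 * g ≤ m * ℓ by nlinarith)
    push_cast at h1 h2
    linarith
  have hA2 : Real.logb 2 n ≤ 6 * ((ℓ : ℝ) ^ 2 * g) := by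
    have h1 : Real.logb 2 n ≤ ((3 * (m * ℓ) : ℕ) : ℝ) := by
      rw [Real.logb_le_iff_le_rpow (by norm_num) hnpos, Real.rpow_natCast]
      exact_mod_cast hn
    have h2 : ((3 * (m * ℓ) : ℕ) : ℝ) ≤ (6 * (ℓ ^ 2 * g) : ℕ) := by
      refine Nat.cast_le.2 ?_
      calc 3 * (m * ℓ) ≤ 3 * (ℓ * (g + 1) * ℓ) :=
            Nat.mul_le_mul_left _ (Nat.mul_le_mul_right _ hm2)
        _ ≤ 3 * (ℓ * (2 * g) * ℓ) := by gcongr; omega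
        _ = 6 * (ℓ ^ 2 * g) := by ring
    push_cast at h1 h2
    linarith
  generalize Real.logb 2 n = A at *
  have hA : 0 < A := lt_of_lt_of_le (by positivity) hA1
  have hB1 : (g : ℝ) ≤ Real.logb 2 A := by
    rw [Real.le_logb_iff_rpow_le (by norm_num) hA, Real.rpow_natCast]
    have : (2 : ℝ) ^ g ≤ ℓ := by exact_mod_cast hge
    nlinarith
  have hB2 : Real.logb 2 A ≤ 8 * g := by
    have h1 : Real.logb 2 A ≤ ((8 * g : ℕ) : ℝ) := by
      rw [Real.logb_le_iff_le_rpow (by norm_num) hA, Real.rpow_natCast]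
      refine hA2.trans ?_
      have h2 : 6 * (ℓ ^ 2 * g) ≤ 2 ^ (8 * g) := by
        calc 6 * (ℓ ^ 2 * g) ≤ 2 ^ 3 * ((2 ^ (g + 1)) ^ 2 * 2 ^ g) :=
              Nat.mul_le_mul (by norm_num) (Nat.mul_le_mul (Nat.pow_le_pow_left hlt.le 2)
                Nat.lt_two_pow_self.le)
          _ = 2 ^ (3 * g + 5) := by ring
          _ ≤ 2 ^ (8 * g) := Nat.pow_le_pow_right (by norm_num) (by omega)
      exact_mod_cast h2
    exact_mod_cast h1
  generalize Real.logb 2 A = B at *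
  have hB : 0 < B := by linarith
  constructor
  · refine Real.le_sqrt_of_sq_le ?_
    rw [le_div_iff₀ hB]
    have : ((ℓ : ℝ) / 3) ^ 2 * B ≤ ((ℓ : ℝ) / 3) ^ 2 * (8 * g) :=
      mul_le_mul_of_nonneg_left hB2 (by positivity)
    nlinarith [sq_nonneg (ℓ : ℝ), mul_nonneg (sq_nonneg (ℓ : ℝ)) (show (0 : ℝ) ≤ g by linarith)]
  · refine Real.sqrt_le_iff.2 ⟨by positivity, ?_⟩
    rw [div_le_iff₀ hB]
    have : (3 * (ℓ : ℝ)) ^ 2 * g ≤ (3 * (ℓ : ℝ)) ^ 2 * B :=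
      mul_le_mul_of_nonneg_left hB1 (by positivity)
    nlinarith [mul_nonneg (sq_nonneg (ℓ : ℝ)) (show (0 : ℝ) ≤ g by linarith)]

end Dyck

/-! ### The asymptotic statement -/

theorem mainTheorem3 :
    (∃ c : ℝ, 0 < c ∧ ∀ᶠ ℓ : ℕ in Filter.atTop,
      c * Dyck.sqrtLogRatio (Dyck.Y ℓ) ≤ (Dyck.width (Dyck.Y ℓ) : ℝ)) ∧
    (∃ c : ℝ, 0 < c ∧ ∀ᶠ ℓ : ℕ in Filter.atTop,
      c * (ℓ : ℝ) ≤ (Dyck.width (Dyck.Y ℓ) : ℝ)) ∧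
    Asymptotics.IsTheta Filter.atTop
      (fun ℓ : ℕ => Dyck.sqrtLogRatio (Dyck.Y ℓ)) (fun ℓ : ℕ => (ℓ : ℝ)) := by
  -- For `ℓ ≥ 10` the integer quotient `ℓ / 10` is at least half of the real one. Dividing by the
  -- `3` of `sqrtLogRatio_Y_bounds` then gives `1 / 60`.
  have hlin : ∀ ℓ : ℕ, 10 ≤ ℓ → (1 / 20 : ℝ) * ℓ ≤ Dyck.width (Dyck.Y ℓ) := by
    intro ℓ hℓ
    have h1 := Dyck.div_le_width_Y (show 6 ≤ ℓ by omega)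
    have h2 : (ℓ : ℝ) ≤ ((20 * Dyck.width (Dyck.Y ℓ) : ℕ) : ℝ) := Nat.cast_le.2 (by omega)
    push_cast at h2
    linarith
  refine ⟨⟨1 / 60, by norm_num, ?_⟩, ⟨1 / 20, by norm_num, ?_⟩, ?_, ?_⟩
  · filter_upwards [Filter.eventually_ge_atTop 10] with ℓ hℓ
    have h1 := hlin ℓ hℓ
    have h2 := (Dyck.sqrtLogRatio_Y_bounds (show 2 ≤ ℓ by omega)).2
    linarith
  · filter_upwards [Filter.eventually_ge_atTop 10] with ℓ hℓ
    exact hlin ℓ hℓ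
  · refine Asymptotics.IsBigO.of_bound 3 ?_
    filter_upwards [Filter.eventually_ge_atTop 2] with ℓ hℓ
    rw [Real.norm_of_nonneg (Nat.cast_nonneg ℓ),
      Real.norm_of_nonneg (show 0 ≤ Dyck.sqrtLogRatio _ from Real.sqrt_nonneg _)]
    exact (Dyck.sqrtLogRatio_Y_bounds hℓ).2
  · refine Asymptotics.IsBigO.of_bound 3 ?_
    filter_upwards [Filter.eventually_ge_atTop 2] with ℓ hℓ
    have := (Dyck.sqrtLogRatio_Y_bounds hℓ).1
    rw [Real.norm_of_nonneg (Nat.cast_nonneg ℓ),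
      Real.norm_of_nonneg (show 0 ≤ Dyck.sqrtLogRatio _ from Real.sqrt_nonneg _)]
    linarith
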